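/- **Convergence as $\nu\to0$ for the magnetogeostrophic equation.** Let $\mathbb T^3=[0,2\pi]^3$ with periodic boundary conditions, $\hat f(k)=(2\pi)^{-3}\int_{\mathbb T^3}f(x)e^{-ik\cdot x}\,dx$ for $k\in\mathbb Z^3$, and $$\|\Lambda^r e^{\tau\Lambda^{1/s}}f\|_{L^2}^2=\sum_{k\in\mathbb Z^3\setminus\{0\}}|k|^{2r}e^{2\tau|k|^{1/s}}|\hat f(k)|^2 .$$ All functions on $\mathbb T^3$ are real-valued with zero mean. For $\nu\ge 0$ consider $$\partial_t\theta+u\cdot\nabla\theta=S,\qquad u=M^\nu[\theta],\qquad \theta(\cdot,0)=\theta_0, \tag{MG$^\nu$}$$ where $\widehat{M_j^\nu[\theta]}(k)=\widehat M_j^\nu(k)\hat\theta(k)$ for $j=1,2,3$, with, for $k_3\ne0$, $$\widehat M_1^\nu(k)=\frac{k_2k_3|k|^2-k_1k_3(k_2^2+\nu|k|^4)}{D(k)},\quad \widehat M_2^\nu(k)=\frac{-k_1k_3|k|^2-k_2k_3(k_2^2+\nu|k|^4)}{D(k)},\quad \widehat M_3^\nu(k)=\frac{(k_1^2+k_2^2)(k_2^2+\nu|k|^4)}{D(k)},$$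 $D(k)=|k|^2k_3^2+(k_2^2+\nu|k|^4)^2$, and $\widehat M^\nu(k)=0$ for $k_3=0$. Fix $s\ge1$, $r>3$, $K_0>0$, $\tau_0>0$. Let $\theta_0$ and $S=S(x)$ satisfy $\|\Lambda^re^{\tau_0\Lambda^{1/s}}\theta_0\|_{L^2}\le K_0$ and $\|\Lambda^re^{\tau_0\Lambda^{1/s}}S\|_{L^2}\le K_0$. Let $\bar T,\bar\tau>0$. By a Gevrey-class $s$ solution of (MG$^\nu$) on $\mathbb T^3\times[0,\bar T]$ with radius of convergence at least $\bar\tau$ we mean a solution $\theta$ with $\sup_{t\in[0,\bar T]}\|\Lambda^re^{\bar\tau\Lambda^{1/s}}\theta(\cdot,t)\|_{L^2}<\infty$. Let $\theta^\nu$ (for every $\nu>0$) and $\theta^0$ (for $\nu=0$) be such solutions, with the same $\theta_0$ and $S$. If $s>1$, suppose moreover that $\theta^0$ is the unique such solution for $\nu=0$ and that there is a constant $C$, independent of $\nu$, with $\|\Lambda^re^{\bar\tau\Lambda^{1/s}}\theta^\nu(\cdot,t)\|_{L^2}\le C$ for all $\nu>0$ and $t\in[0,\bar T]$ (for $s=1$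 neither of these two properties is assumed). Then there exist $T$ with $0<T<\bar T$ and a continuous function $\tau:[0,T]\to(0,\bar\tau)$ such that, for every $t\in[0,T]$, $$\lim_{\nu\to0^+}\big\|\Lambda^re^{\tau(t)\Lambda^{1/s}}(\theta^\nu-\theta^0)(\cdot,t)\big\|_{L^2}=0 .$$ -/

import Mathlib

open Filter Topology MeasureTheory Set
open scoped ENNReal NNReal

noncomputable section

namespace MG

/-- Points of `ℝ³`. A function on the torus `𝕋³ = [0, 2π]³` is a function on `ℝ³` which is
`2π`-periodic in each of the three coordinates. -/
abbrev Space := Fin 3 → ℝ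

/-- Fourier frequencies; the coordinates `k₁, k₂, k₃` are `k 0, k 1, k 2`. -/
abbrev Freq := Fin 3 → ℤ

/-- The periodicity cell `[0, 2π]³`. -/
def cell : Set Space := Icc 0 (fun _ => 2 * Real.pi)

/-- `|k|²`, for the Euclidean length. -/
def freqSq (k : Freq) : ℝ := ∑ i, (k i : ℝ) ^ 2

/-- `|k|`, the Euclidean length. -/
def freqAbs (k : Freq) : ℝ := Real.sqrt (freqSq k)

/-- The character `x ↦ exp(i k·x)`. -/
def mode (k : Freq) (x : Space) : ℂ :=
  Complex.exp (Complex.I * ((∑ i, (k i : ℝ) * x i : ℝ) : ℂ))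

/-- The Fourier coefficient `f̂(k) = (2π)⁻³ ∫_{[0,2π]³} f(x) exp(-i k·x) dx`. -/
def fourierCoef (f : Space → ℝ) (k : Freq) : ℂ :=
  (((2 * Real.pi) ^ 3 : ℝ) : ℂ)⁻¹ * ∫ x in cell, (f x : ℂ) * mode (-k) x

/-- `k₂² + ν |k|⁴`. -/
def symbolA (ν : ℝ) (k : Freq) : ℝ := (k 1 : ℝ) ^ 2 + ν * freqSq k ^ 2

/-- The denominator `D(k) = |k|² k₃² + (k₂² + ν |k|⁴)²`. -/
def symbolD (ν : ℝ) (k : Freq) : ℝ := freqSq k * (k 2 : ℝ) ^ 2 + symbolA ν k ^ 2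

/-- The Fourier symbol of the operator `M^ν` that gives the velocity from the scalar. As is
standard for this model (the velocity has zero vertical mean) it is `0` on the plane `k₃ = 0`,
on part of which the quotients are not defined for `ν = 0`. -/
def symbolM (ν : ℝ) (k : Freq) : Fin 3 → ℝ :=
  if k 2 = 0 then 0 else
    ![((k 1 : ℝ) * k 2 * freqSq k - k 0 * k 2 * symbolA ν k) / symbolD ν k,
      (-((k 0 : ℝ) * k 2 * freqSq k) - k 1 * k 2 * symbolA ν k) / symbolD ν k,
      (((k 0 : ℝ) ^ 2 + (k 1 : ℝ) ^ 2) * symbolA ν k) / symbolD ν k]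

/-- The component `u_j = M_j^ν[f]` of the velocity, `∑_k M̂_j^ν(k) f̂(k) exp(i k·x)`. The series
converges absolutely for the Gevrey functions below and its sum is real. -/
def velocity (ν : ℝ) (f : Space → ℝ) (j : Fin 3) (x : Space) : ℝ :=
  (∑' k : Freq, (symbolM ν k j : ℂ) * fourierCoef f k * mode k x).re

/-- `(u · ∇) f` at the point `x`, where `u = M^ν[f]`. -/
def advection (ν : ℝ) (f : Space → ℝ) (x : Space) : ℝ :=
  ∑ j, velocity ν f j x * fderiv ℝ f x (Pi.single j 1)

/-- The norm `‖Λ^r exp(τ Λ^{1/s}) f‖_{L²}`, that is the square root of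
`∑_{k ≠ 0} |k|^{2r} exp(2 τ |k|^{1/s}) |f̂(k)|²`, with values in `[0, ∞]`. -/
def gevreyNorm (s r τ : ℝ) (f : Space → ℝ) : ℝ≥0∞ :=
  (∑' k : {k : Freq // k ≠ 0},
    ENNReal.ofReal (freqAbs k ^ (2 * r) * Real.exp (2 * τ * freqAbs k ^ (1 / s))
      * ‖fourierCoef f k‖ ^ 2)) ^ (1 / 2 : ℝ)

/-- `f` is a function on `𝕋³` with zero mean, of Gevrey class `s` with radius of convergence at
least `τ`: it lies in the domain of `Λ^r exp(τ Λ^{1/s})`. -/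
structure IsGevrey (s r τ : ℝ) (f : Space → ℝ) : Prop where
  continuous : Continuous f
  periodic : ∀ i, Function.Periodic f (Pi.single i (2 * Real.pi))
  mean_zero : ∫ x in cell, f x = 0
  norm_lt_top : gevreyNorm s r τ f < ∞

/-- `θ` is, on `𝕋³ × [0, T]`, a solution of Gevrey class `s` with radius of convergence at least
`τ` of `∂ₜθ + u · ∇θ = S`, `u = M^ν[θ]`, `θ(·, 0) = θ₀`. -/
structure IsGevreySolution (s r τ T ν : ℝ) (S θ₀ : Space → ℝ) (θ : ℝ → Space → ℝ) : Prop where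
  gevrey : ∀ t ∈ Icc 0 T, IsGevrey s r τ (θ t)
  bounded : ∃ C : ℝ≥0, ∀ t ∈ Icc 0 T, gevreyNorm s r τ (θ t) ≤ C
  initial : θ 0 = θ₀
  equation : ∀ t ∈ Icc 0 T, ∀ x,
    HasDerivWithinAt (fun t' => θ t' x) (S x - advection ν (θ t) x) (Icc 0 T) t

end MG

end

namespace MG

/-! The symbol obeys `|M̂_j^ν(k)| ≤ 2|k|` uniformly in `ν ≥ 0` (`abs_symbolM_le`) and is continuous
in `ν` at each fixed `k`. By dominated convergence (`tendsto_gevreyNorm_sub`), Gevrey convergence at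
a radius follows from convergence of every Fourier coefficient together with a `ν`-independent
exponential bound at a strictly larger radius. It remains to supply these two ingredients.

For `s > 1` the uniform bound is a hypothesis, and the coefficients converge by compactness. Along
any ultrafilter of viscosities tending to `0⁺` the bounded coefficients have limits. The limit
function solves the inviscid equation, because a first-order Taylor estimate in time with a
`ν`-independent constant survives the limit (`exists_limit_solution`). Uniqueness identifies all
these limits with the given inviscid solution, hence the whole family converges.

For `s = 1` neither hypothesis is available, and the tool is an `ℓ¹` norm of Fourier coefficients
with weight `exp((ρ/2 - κt)|k|)`. Since this weight is submultiplicative, convolutions are bounded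
by products of norms. The shrinking radius produces a damping term with one extra factor `|k|`,
which absorbs the derivative lost in `u · ∇θ` once `κ` is large. A barrier argument
(`tsum_exp_mul_norm_le`) gives a bound depending only on the data (`DecaySolution.tsum_le`). The
same argument for the difference of two solutions, one derivative lower, bounds it by the weighted
distance between the two symbols (`norm_fourierCoef_sub_le_of_tsum_le`), which tends to `0`. The
bounds assumed for the individual solutions, which may depend on `ν`, only justify termwise
differentiation of the series. -/

/-! ### Frequencies and bounds on the symbol that are uniform in the viscosity. -/

theorem freqSq_nonneg (k : Freq) : 0 ≤ freqSq k := Finset.sum_nonneg fun _ _ => sq_nonneg _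

theorem freqAbs_nonneg (k : Freq) : 0 ≤ freqAbs k := Real.sqrt_nonneg _

theorem sq_freqAbs (k : Freq) : freqAbs k ^ 2 = freqSq k := Real.sq_sqrt (freqSq_nonneg k)

theorem freqSq_neg (k : Freq) : freqSq (-k) = freqSq k := by simp [freqSq]

theorem sq_le_freqSq (k : Freq) (i : Fin 3) : (k i : ℝ) ^ 2 ≤ freqSq k :=
  Finset.single_le_sum (f := fun i => (k i : ℝ) ^ 2) (fun _ _ => sq_nonneg _) (Finset.mem_univ i)

theorem abs_le_freqAbs (k : Freq) (i : Fin 3) : |(k i : ℝ)| ≤ freqAbs k :=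
  Real.abs_le_sqrt (sq_le_freqSq k i)

theorem one_le_abs_intCast {n : ℤ} (h : n ≠ 0) : (1 : ℝ) ≤ |(n : ℝ)| := by
  exact_mod_cast Int.one_le_abs h

theorem one_le_freqAbs {k : Freq} (hk : k ≠ 0) : 1 ≤ freqAbs k := by
  obtain ⟨i, hi⟩ := Function.ne_iff.mp hk
  exact (one_le_abs_intCast hi).trans (abs_le_freqAbs k i)

theorem freqAbs_eq_norm (k : Freq) :
    freqAbs k = ‖(WithLp.toLp 2 (fun i => (k i : ℝ)) : EuclideanSpace ℝ (Fin 3))‖ := by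
  simp [EuclideanSpace.norm_eq, freqAbs, freqSq]

theorem freqAbs_add_le (k l : Freq) : freqAbs (k + l) ≤ freqAbs k + freqAbs l := by
  simp only [freqAbs_eq_norm]
  refine le_trans (le_of_eq ?_) (norm_add_le _ _)
  rw [← WithLp.toLp_add]
  congr 2
  ext i
  simp

theorem freqAbs_le_add_sub (k l : Freq) : freqAbs k ≤ freqAbs l + freqAbs (k - l) := by
  simpa using freqAbs_add_le l (k - l)

theorem symbolA_nonneg {ν : ℝ} (hν : 0 ≤ ν) (k : Freq) : 0 ≤ symbolA ν k := by
  unfold symbolA; positivity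

theorem symbolD_pos {k : Freq} (hk : k 2 ≠ 0) (ν : ℝ) : 0 < symbolD ν k := by
  have h2 : 0 < (k 2 : ℝ) ^ 2 := by positivity
  have h3 := h2.trans_le (sq_le_freqSq k 2)
  have := mul_pos h3 h2
  unfold symbolD
  positivity

/-- With `A = symbolA ν k`, the denominator is `(|k||k₃|)² + A²`, so it dominates `2|k||k₃|A`.
Integrality gives `|k₃| ≥ 1`, `|k| ≥ 1` and `|k₂| ≤ k₂² ≤ A`, which brings nearly every numerator
term below `|k| · |k||k₃|A`. The exception is `k₁k₃|k|²` in the second component, which has no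
factor `k₂`; it is compared with the square `(|k||k₃|)²` directly. -/
theorem abs_symbolM_le {ν : ℝ} (hν : 0 ≤ ν) (k : Freq) (j : Fin 3) :
    |symbolM ν k j| ≤ 2 * freqAbs k := by
  unfold symbolM
  split_ifs with hk
  · simpa using freqAbs_nonneg k
  have hD := symbolD_pos hk ν
  have hA := symbolA_nonneg hν k
  have hR := freqAbs_nonneg k
  have h3 : (1 : ℝ) ≤ |(k 2 : ℝ)| := one_le_abs_intCast hk
  have hR1 : 1 ≤ freqAbs k := h3.trans (abs_le_freqAbs k 2)
  have h0R := abs_le_freqAbs k 0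
  have h1R := abs_le_freqAbs k 1
  have hAk : |(k 1 : ℝ)| ^ 2 ≤ symbolA ν k := by
    rw [sq_abs]; unfold symbolA
    have : 0 ≤ ν * freqSq k ^ 2 := by positivity
    linarith
  have hDe : symbolD ν k = (freqAbs k * |(k 2 : ℝ)|) ^ 2 + symbolA ν k ^ 2 := by
    rw [mul_pow, sq_freqAbs, sq_abs]; rfl
  have hamgm : 2 * (freqAbs k * |(k 2 : ℝ)|) * symbolA ν k ≤ symbolD ν k := by
    rw [hDe]; exact two_mul_le_add_sq _ _
  have ha : 0 ≤ |(k 1 : ℝ)| := abs_nonneg _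
  have h01 : |(k 1 : ℝ)| ≤ |(k 1 : ℝ)| ^ 2 := by
    by_cases h : k 1 = 0
    · simp [h]
    · nlinarith [one_le_abs_intCast h]
  set R := freqAbs k
  set c := |(k 2 : ℝ)|
  set A := symbolA ν k
  have hRcA : 0 ≤ R * c * A := by positivity
  fin_cases j
  · simp only [Fin.zero_eta, Matrix.cons_val_zero]
    rw [abs_div, abs_of_pos hD, div_le_iff₀ hD]
    refine (abs_sub _ _).trans ?_
    rw [abs_mul, abs_mul, abs_mul, abs_mul, abs_of_nonneg hA, abs_of_nonneg (freqSq_nonneg k),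
      ← sq_freqAbs]
    have e1 : |(k 1 : ℝ)| * c * R ^ 2 ≤ R * (R * c * A) := by
      have : |(k 1 : ℝ)| * (c * R ^ 2) ≤ A * (c * R ^ 2) := by gcongr; exact h01.trans hAk
      linarith [this]
    have e2 : |(k 0 : ℝ)| * c * A ≤ R * (R * c * A) := by
      calc |(k 0 : ℝ)| * c * A ≤ R * c * A := by gcongr
        _ ≤ R * (R * c * A) := le_mul_of_one_le_left hRcA hR1
    calc _ ≤ R * (2 * (R * c) * A) := by linarith
      _ ≤ R * symbolD ν k := by gcongr
      _ ≤ _ := by nlinarith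
  · simp only [Fin.mk_one, Matrix.cons_val_one, Matrix.cons_val_zero]
    rw [abs_div, abs_of_pos hD, div_le_iff₀ hD]
    refine (abs_sub _ _).trans ?_
    rw [abs_neg, abs_mul, abs_mul, abs_mul, abs_mul, abs_of_nonneg hA,
      abs_of_nonneg (freqSq_nonneg k), ← sq_freqAbs]
    have e1 : |(k 1 : ℝ)| * c * A ≤ R * (R * c * A) := by
      calc |(k 1 : ℝ)| * c * A ≤ R * c * A := by gcongr
        _ ≤ R * (R * c * A) := le_mul_of_one_le_left hRcA hR1
    have e2 : |(k 0 : ℝ)| * c * R ^ 2 ≤ R * (R * c) ^ 2 := by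
      calc |(k 0 : ℝ)| * c * R ^ 2 ≤ R * c * R ^ 2 := by gcongr
        _ ≤ R * c * R ^ 2 * c := le_mul_of_one_le_right (by positivity) h3
        _ = _ := by ring
    have e3 : R * (R * c) ^ 2 ≤ R * symbolD ν k := by
      gcongr; rw [hDe]; exact le_add_of_nonneg_right (sq_nonneg A)
    have e4 : R * (2 * (R * c) * A) ≤ R * symbolD ν k := by gcongr
    change |(k 0 : ℝ)| * c * R ^ 2 + |(k 1 : ℝ)| * c * A ≤ 2 * R * symbolD ν k
    linarith [mul_nonneg hR hRcA]
  · simp only [Fin.reduceFinMk, Matrix.cons_val]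
    rw [abs_div, abs_of_pos hD, div_le_iff₀ hD, abs_mul, abs_of_nonneg hA,
      abs_of_nonneg (by positivity)]
    have : (k 0 : ℝ) ^ 2 + (k 1 : ℝ) ^ 2 ≤ R ^ 2 := by
      rw [sq_freqAbs]; simp only [freqSq, Fin.sum_univ_three]; nlinarith [sq_nonneg (k 2 : ℝ)]
    calc _ ≤ R ^ 2 * A := by gcongr
      _ ≤ R ^ 2 * A * c := le_mul_of_one_le_right (by positivity) h3
      _ = R * (R * c * A) := by ring
      _ ≤ R * (2 * (R * c) * A) := by linarith [mul_nonneg hR hRcA]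
      _ ≤ R * symbolD ν k := by gcongr
      _ ≤ _ := by nlinarith

theorem sum_abs_symbolM_le {ν : ℝ} (hν : 0 ≤ ν) (k : Freq) :
    ∑ j, |symbolM ν k j| ≤ 6 * freqAbs k := by
  simp only [Fin.sum_univ_three]
  linarith [abs_symbolM_le hν k 0, abs_symbolM_le hν k 1, abs_symbolM_le hν k 2]

theorem symbolM_neg (ν : ℝ) (k : Freq) : symbolM ν (-k) = symbolM ν k := by
  have hA : symbolA ν (-k) = symbolA ν k := by simp [symbolA, freqSq_neg]
  have hD : symbolD ν (-k) = symbolD ν k := by simp [symbolD, freqSq_neg, hA]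
  ext j
  unfold symbolM
  simp [hA, hD, freqSq_neg]

theorem tendsto_symbolM (k : Freq) (j : Fin 3) :
    Tendsto (fun ν => symbolM ν k j) (𝓝 0) (𝓝 (symbolM 0 k j)) := by
  by_cases hk : k 2 = 0
  · simp [symbolM, hk]
  have hA : Continuous fun ν => symbolA ν k := by unfold symbolA; fun_prop
  have hD : Continuous fun ν => symbolD ν k := by unfold symbolD; fun_prop
  have hne : ∀ ν, symbolD ν k ≠ 0 := fun ν => (symbolD_pos hk ν).ne'
  refine Continuous.tendsto ?_ 0
  simp only [symbolM, hk, if_false]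
  fin_cases j
  · exact Continuous.div (by fun_prop) hD hne
  · exact Continuous.div (by fun_prop) hD hne
  · exact Continuous.div (by fun_prop) hD hne

theorem freqAbs_rpow_nonneg (k : Freq) (p : ℝ) : 0 ≤ freqAbs k ^ p :=
  Real.rpow_nonneg (freqAbs_nonneg k) p

/-! ### Summability of polynomial times exponential weights. -/

/-- Apply `yⁿ / n! ≤ exp y` to `y = δ x^(1/s)` with `n ≥ s p`, so that `(x^(1/s))ⁿ ≥ x^p`. -/
theorem exists_pow_mul_exp_neg_le {s δ : ℝ} (hs : 0 < s) (hδ : 0 < δ) (p : ℕ) :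
    ∃ C : ℝ, 0 ≤ C ∧ ∀ x : ℝ, 1 ≤ x → x ^ p * Real.exp (-(δ * x ^ (1 / s))) ≤ C := by
  obtain ⟨n, hn⟩ := exists_nat_ge (s * p)
  refine ⟨n.factorial / δ ^ n, by positivity, fun x hx => ?_⟩
  have hx0 : 0 < x := by linarith
  have h1 := Real.pow_div_factorial_le_exp (δ * x ^ (1 / s)) (by positivity) n
  have h2 : x ^ p ≤ (x ^ (1 / s)) ^ n := by
    rw [← Real.rpow_mul_natCast hx0.le, ← Real.rpow_natCast]
    refine Real.rpow_le_rpow_of_exponent_le hx ?_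
    rw [one_div_mul_eq_div, le_div_iff₀ hs]
    linarith
  rw [Real.exp_neg, ← div_eq_mul_inv, div_le_div_iff₀ (Real.exp_pos _) (by positivity)]
  rw [div_le_iff₀ (by positivity), mul_pow] at h1
  calc x ^ p * δ ^ n ≤ (x ^ (1 / s)) ^ n * δ ^ n := by gcongr
    _ = δ ^ n * (x ^ (1 / s)) ^ n := mul_comm _ _
    _ ≤ _ := by rw [mul_comm (n.factorial : ℝ)]; exact h1

theorem summable_prod_inv_one_add_sq :
    Summable fun k : Freq => ∏ i, (1 + (k i : ℝ) ^ 2)⁻¹ := by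
  have h1 : Summable fun n : ℤ => (1 + (n : ℝ) ^ 2)⁻¹ := by
    have := (Real.summable_one_div_int_pow (p := 2)).mpr one_lt_two
    refine Summable.of_norm_bounded_eventually this ?_
    refine (Set.finite_singleton (0 : ℤ)).subset fun n hn => ?_
    by_contra h0
    apply hn
    have : 0 < (n : ℝ) ^ 2 := by
      have : (n : ℝ) ≠ 0 := by exact_mod_cast h0
      positivity
    change ‖_‖ ≤ _
    rw [Real.norm_of_nonneg (by positivity), one_div]
    gcongr
    linarith
  have h0 : ∀ n : ℤ, (0 : ℝ) ≤ (1 + (n : ℝ) ^ 2)⁻¹ := fun n => by positivity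
  have h2 := h1.mul_of_nonneg h1 h0 h0
  have h3 := h1.mul_of_nonneg h2 h0 fun p => mul_nonneg (h0 _) (h0 _)
  have hinj : Function.Injective fun k : Freq => (k 0, k 1, k 2) := by
    intro k l h
    simp only [Prod.mk.injEq] at h
    ext i
    fin_cases i <;> simp [h]
  refine (h3.comp_injective hinj).congr fun k => ?_
  simp only [Fin.prod_univ_three, mul_assoc, Function.comp_apply]

/-- Polynomial weights are absorbed by the exponential ones. -/
theorem summable_pow_mul_exp_neg {s δ : ℝ} (hs : 0 < s) (hδ : 0 < δ) (p : ℕ) :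
    Summable fun k : Freq =>
      (1 + freqAbs k) ^ p * Real.exp (-(δ * freqAbs k ^ (1 / s))) := by
  -- The six additional powers of `|k|` pay for `∏ (1 + k_i²) ≤ 8|k|⁶`, whose inverse is summable.
  obtain ⟨C, hC0, hC⟩ := exists_pow_mul_exp_neg_le hs hδ (p + 6)
  refine Summable.of_norm_bounded_eventually
    (summable_prod_inv_one_add_sq.mul_left (2 ^ p * 8 * C)) ?_
  refine (Set.finite_singleton (0 : Freq)).subset fun k hk => ?_
  by_contra h0
  apply hk
  have h1 := one_le_freqAbs h0
  set x := freqAbs k with hx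
  have hpos : 0 < x := by linarith
  change ‖_‖ ≤ _
  rw [Real.norm_of_nonneg (by positivity)]
  have hprod : ∏ i, (1 + (k i : ℝ) ^ 2) ≤ 8 * x ^ 6 := by
    have hi : ∀ i, 1 + (k i : ℝ) ^ 2 ≤ 2 * x ^ 2 := fun i => by
      have := sq_le_freqSq k i
      rw [← sq_freqAbs] at this
      nlinarith
    calc ∏ i, (1 + (k i : ℝ) ^ 2) ≤ ∏ _i : Fin 3, (2 * x ^ 2) :=
          Finset.prod_le_prod (fun i _ => by positivity) fun i _ => hi i
      _ = 8 * x ^ 6 := by simp; ring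
  have hprodpos : 0 < ∏ i, (1 + (k i : ℝ) ^ 2) := Finset.prod_pos fun i _ => by positivity
  rw [Finset.prod_inv_distrib, ← div_eq_mul_inv, le_div_iff₀ hprodpos]
  set E := Real.exp (-(δ * x ^ (1 / s)))
  have hE : 0 < E := Real.exp_pos _
  calc (1 + x) ^ p * E * ∏ i, (1 + (k i : ℝ) ^ 2) ≤ (2 * x) ^ p * E * (8 * x ^ 6) := by
        gcongr; linarith
    _ = 2 ^ p * 8 * (x ^ (p + 6) * E) := by ring
    _ ≤ 2 ^ p * 8 * C := by gcongr; exact hC x h1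

/-! ### Fourier series on the torus of period `2π`. -/

/-- The covering of the torus by `ℝ³`, with the period normalised to `1`. -/
noncomputable def toTorus (x : Space) : UnitAddTorus (Fin 3) :=
  fun i => ((x i / (2 * Real.pi) : ℝ) : UnitAddCircle)

theorem mode_eq_mFourier (k : Freq) (x : Space) : mode k x = UnitAddTorus.mFourier k (toTorus x) := by
  have hpi : (Real.pi : ℂ) ≠ 0 := by exact_mod_cast Real.pi_ne_zero
  simp only [mode, UnitAddTorus.mFourier, toTorus, ContinuousMap.coe_mk, fourier_coe_apply]
  rw [← Complex.exp_sum]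
  congr 1
  push_cast
  rw [Finset.mul_sum]
  refine Finset.sum_congr rfl fun i _ => ?_
  field_simp

theorem isOpenQuotientMap_toTorus : IsOpenQuotientMap toTorus := by
  have h : IsOpenQuotientMap fun t : ℝ => ((t / (2 * Real.pi) : ℝ) : UnitAddCircle) :=
    QuotientAddGroup.isOpenQuotientMap_mk.comp
      (Homeomorph.mulRight₀ (2 * Real.pi)⁻¹ (by positivity)).isOpenQuotientMap
  exact IsOpenQuotientMap.piMap fun _ : Fin 3 => h

theorem eq_of_toTorus_eq {E : Type*} {f : Space → E}
    (hf : ∀ i, Function.Periodic f (Pi.single i (2 * Real.pi))) {x y : Space}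
    (h : toTorus x = toTorus y) : f x = f y := by
  have h1 : ∀ i, ∃ n : ℤ, y i = x i + n * (2 * Real.pi) := fun i => by
    have := congrFun h i
    simp only [toTorus] at this
    rw [eq_comm, ← sub_eq_zero, ← AddCircle.coe_sub, AddCircle.coe_eq_zero_iff] at this
    obtain ⟨n, hn⟩ := this
    refine ⟨n, ?_⟩
    rw [zsmul_eq_mul, mul_one, ← sub_div, eq_div_iff (by positivity)] at hn
    linarith
  choose n hn using h1
  have h2 : y = x + ∑ i, n i • (Pi.single i (2 * Real.pi) : Space) := by
    ext j
    rw [hn j]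
    simp [Finset.sum_apply, Pi.single_apply]
  have h3 : ∀ (t : Finset (Fin 3)),
      f (x + ∑ i ∈ t, n i • (Pi.single i (2 * Real.pi) : Space)) = f x := fun t => by
    induction t using Finset.induction_on with
    | empty => simp
    | insert i t hi ih =>
      rw [Finset.sum_insert hi, add_comm (n i • _), ← add_assoc, (hf i).zsmul (n i), ih]
  rw [h2, h3]

open scoped Pointwise in
-- Scaling by `2π` maps the unit cube to `cell`, and its Jacobian is exactly the normalising factor.
-- This gives access to the Fourier theory of `UnitAddTorus`.
theorem integral_cell_mul_mode {g : Space → ℂ} {F : UnitAddTorus (Fin 3) → ℂ}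
    (h : ∀ x, F (toTorus x) = g x) (k : Freq) :
    (((2 * Real.pi) ^ 3 : ℝ) : ℂ)⁻¹ * ∫ x in cell, g x * mode (-k) x =
      UnitAddTorus.mFourierCoeff F k := by
  have hpi : 0 < 2 * Real.pi := by positivity
  rw [UnitAddTorus.mFourierCoeff_eq_integral F k 0]
  have hset : {x : Space | ∀ i, x i ∈ Ioc ((0 : Space) i) ((0 : Space) i + 1)} =
      univ.pi fun i => Ioc ((0 : Space) i) ((1 : Space) i) := by
    ext; simp
  have hpt : ∀ y : Space, (fun i => ((y i : ℝ) : UnitAddCircle)) = toTorus ((2 * Real.pi) • y) := by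
    intro y; ext i; simp [toTorus, mul_div_cancel_left₀ _ hpi.ne']
  rw [hset, setIntegral_congr_set (μ := volume)
    (Measure.univ_pi_Ioc_ae_eq_Icc (μ := fun _ => volume) (f := (0 : Space)) (g := 1))]
  simp only [hpt, ← mode_eq_mFourier, h]
  rw [Measure.setIntegral_comp_smul volume (fun x => mode (-k) x • g x) _ hpi.ne']
  have hcell : ((2 * Real.pi) • Icc (0 : Space) 1 : Set Space) = cell := by
    ext x
    rw [Set.mem_smul_set_iff_inv_smul_mem₀ hpi.ne']
    simp only [cell, mem_Icc, Pi.le_def, Pi.smul_apply, smul_eq_mul, Pi.zero_apply, Pi.one_apply,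
      inv_mul_le_one₀ hpi]
    refine and_congr (forall_congr' fun i => ?_) Iff.rfl
    exact ⟨fun h => by simpa [hpi.ne', ← mul_assoc] using mul_nonneg hpi.le h,
      fun h => by positivity⟩
  rw [hcell, Module.finrank_fin_fun, abs_of_nonneg (by positivity), ← Complex.ofReal_inv,
    ← Complex.real_smul]
  simp only [smul_eq_mul, mul_comm]

theorem fourierCoef_eq_mFourierCoeff {f : Space → ℝ} {F : UnitAddTorus (Fin 3) → ℂ}
    (h : ∀ x, F (toTorus x) = f x) (k : Freq) :
    fourierCoef f k = UnitAddTorus.mFourierCoeff F k :=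
  integral_cell_mul_mode h k

theorem norm_mode (k : Freq) (x : Space) : ‖mode k x‖ = 1 := by
  rw [mode, mul_comm, Complex.norm_exp_ofReal_mul_I]

theorem continuous_mode (k : Freq) : Continuous (mode k) := by
  unfold mode; fun_prop

theorem isCompact_cell : IsCompact cell := isCompact_Icc

theorem mFourierCoeff_mFourier (m k : Freq) :
    UnitAddTorus.mFourierCoeff (UnitAddTorus.mFourier m) k = if k = m then 1 else 0 := by
  classical
  rw [← UnitAddTorus.mFourierCoeff_toLp, ← UnitAddTorus.mFourierBasis_repr]
  have := UnitAddTorus.mFourierBasis.repr_self (𝕜 := ℂ) m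
  rw [UnitAddTorus.coe_mFourierBasis] at this
  change (UnitAddTorus.mFourierBasis.repr (UnitAddTorus.mFourierLp 2 m)) k = _
  rw [this, lp.single_apply]
  simp [Pi.single_apply]

/-- The coefficients of an absolutely convergent trigonometric series are its Fourier
coefficients. -/
theorem fourierCoef_of_hasSum {f : Space → ℝ} {a : Freq → ℂ} (ha : Summable a)
    (h : ∀ x, HasSum (fun k => a k * mode k x) (f x)) (k : Freq) : fourierCoef f k = a k := by
  have hpi : (((2 * Real.pi) ^ 3 : ℝ) : ℂ) ≠ 0 := by
    exact_mod_cast (by positivity : (0 : ℝ) < (2 * Real.pi) ^ 3).ne'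
  have hint : ∀ l, IntegrableOn (fun x => a l * mode l x * mode (-k) x) cell := fun l =>
    ((((continuous_mode l).const_mul _).mul (continuous_mode _)).continuousOn).integrableOn_compact
      isCompact_cell
  have hnorm : ∀ l x, ‖a l * mode l x * mode (-k) x‖ = ‖a l‖ := fun l x => by
    simp [norm_mode]
  have hsum : Summable fun l => ∫ x in cell, ‖a l * mode l x * mode (-k) x‖ := by
    simp only [hnorm, setIntegral_const, smul_eq_mul]
    exact ha.norm.mul_left _
  have h1 := (hasSum_integral_of_summable_integral_norm hint hsum).mul_left
    (((2 * Real.pi) ^ 3 : ℝ) : ℂ)⁻¹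
  have h2 : ∀ l, (((2 * Real.pi) ^ 3 : ℝ) : ℂ)⁻¹ * ∫ x in cell, a l * mode l x * mode (-k) x =
      if l = k then a k else 0 := fun l => by
    have := integral_cell_mul_mode (g := mode l) (fun x => (mode_eq_mFourier l x).symm) k
    simp only [mul_assoc, integral_const_mul]
    rw [mul_left_comm, this, mFourierCoeff_mFourier]
    by_cases hlk : l = k
    · simp [hlk]
    · simp [hlk, Ne.symm hlk]
  simp only [h2] at h1
  have h3 : ∀ x, ∑' l, a l * mode l x * mode (-k) x = f x * mode (-k) x := fun x =>
    ((h x).mul_right _).tsum_eq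
  simp only [h3] at h1
  exact h1.unique (hasSum_ite_eq k (a k))

/-- Periodicity lets `f` descend through the quotient map `toTorus` to a continuous function; with
summable coefficients its Fourier series then converges to it at every point. -/
theorem hasSum_fourierCoef_mul_mode {f : Space → ℝ} (hc : Continuous f)
    (hp : ∀ i, Function.Periodic f (Pi.single i (2 * Real.pi)))
    (hs : Summable (fourierCoef f)) (x : Space) :
    HasSum (fun k => fourierCoef f k * mode k x) (f x) := by
  let π : C(Space, UnitAddTorus (Fin 3)) := ⟨toTorus, isOpenQuotientMap_toTorus.continuous⟩
  let g : C(Space, ℂ) := ⟨fun x => (f x : ℂ), Complex.continuous_ofReal.comp hc⟩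
  have hπ : IsQuotientMap π := isOpenQuotientMap_toTorus.isQuotientMap
  obtain ⟨F, hFg⟩ : ∃ F : C(UnitAddTorus (Fin 3), ℂ), F.comp π = g :=
    ⟨_, hπ.lift_comp g fun a b (hab : toTorus a = toTorus b) =>
      congrArg Complex.ofReal (eq_of_toTorus_eq hp hab)⟩
  have hF : ∀ x, F (toTorus x) = f x := fun x => DFunLike.congr_fun hFg x
  have hcoef := fun k => fourierCoef_eq_mFourierCoeff hF k
  have := UnitAddTorus.hasSum_mFourier_series_apply_of_summable (f := F)
    (hs.congr hcoef) (toTorus x)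
  simpa [hF, ← mode_eq_mFourier, ← hcoef] using this

theorem mode_zero (x : Space) : mode 0 x = 1 := by simp [mode]

theorem mode_add (k l : Freq) (x : Space) : mode (k + l) x = mode k x * mode l x := by
  simp only [mode, ← Complex.exp_add, ← mul_add, ← Complex.ofReal_add, ← Finset.sum_add_distrib]
  simp [add_mul]

theorem mode_neg (k : Freq) (x : Space) : mode (-k) x = (starRingEnd ℂ) (mode k x) := by
  simp [mode, ← Complex.exp_conj]

theorem fourierCoef_neg (f : Space → ℝ) (k : Freq) :
    fourierCoef f (-k) = (starRingEnd ℂ) (fourierCoef f k) := by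
  simp only [fourierCoef, map_mul, map_inv₀, Complex.conj_ofReal, ← integral_conj, ← mode_neg]

theorem fourierCoef_zero {f : Space → ℝ} (hf : ∫ x in cell, f x = 0) : fourierCoef f 0 = 0 := by
  simp only [fourierCoef, neg_zero, mode_zero, mul_one]
  rw [integral_complex_ofReal, hf]
  simp

theorem integrableOn_mul_mode {f : Space → ℝ} (hf : Continuous f) (k : Freq) :
    IntegrableOn (fun x => (f x : ℂ) * mode k x) cell :=
  ((Complex.continuous_ofReal.comp hf).mul (continuous_mode k)).continuousOn.integrableOn_compact
    isCompact_cell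

theorem fourierCoef_sub {f g : Space → ℝ} (hf : Continuous f) (hg : Continuous g) (k : Freq) :
    fourierCoef (f - g) k = fourierCoef f k - fourierCoef g k := by
  simp only [fourierCoef, Pi.sub_apply, Complex.ofReal_sub, sub_mul]
  rw [integral_sub (integrableOn_mul_mode hf _) (integrableOn_mul_mode hg _), mul_sub]

theorem norm_fourierCoef_le_of_abs_le {f : Space → ℝ} {B : ℝ}
    (hB : ∀ x, |f x| ≤ B) (k : Freq) : ‖fourierCoef f k‖ ≤ B := by
  have hvol : volume.real cell = (2 * Real.pi) ^ 3 := by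
    simp [cell, Measure.real, Real.volume_Icc_pi, Real.pi_pos.le]
  have h := norm_setIntegral_le_of_norm_le_const (μ := volume) (s := cell)
    (f := fun x => (f x : ℂ) * mode (-k) x) (C := B) isCompact_cell.measure_lt_top
    fun x _ => by simpa [norm_mode] using hB x
  rw [hvol] at h
  have hpi : (0 : ℝ) < (2 * Real.pi) ^ 3 := by positivity
  rw [fourierCoef, norm_mul, norm_inv, Complex.norm_real, Real.norm_of_nonneg hpi.le,
    inv_mul_le_iff₀ hpi]
  linarith

/-! ### Exponential decay of coefficients versus Gevrey norms. -/

/-- The weight `exp(τ |k|^{1/s})`. -/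
noncomputable def expWeight (s τ : ℝ) (k : Freq) : ℝ := Real.exp (τ * freqAbs k ^ (1 / s))

theorem expWeight_pos (s τ : ℝ) (k : Freq) : 0 < expWeight s τ k := Real.exp_pos _

theorem expWeight_mul (s τ τ' : ℝ) (k : Freq) :
    expWeight s τ k * expWeight s τ' k = expWeight s (τ + τ') k := by
  rw [expWeight, expWeight, expWeight, ← Real.exp_add, add_mul]

theorem expWeight_le_expWeight {τ τ' : ℝ} (h : τ ≤ τ') (s : ℝ) (k : Freq) :
    expWeight s τ k ≤ expWeight s τ' k :=
  Real.exp_le_exp.mpr (mul_le_mul_of_nonneg_right h (freqAbs_rpow_nonneg k _))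

theorem summable_pow_mul_expWeight {s τ : ℝ} (hs : 0 < s) (hτ : τ < 0) (p : ℕ) :
    Summable fun k : Freq => (1 + freqAbs k) ^ p * expWeight s τ k := by
  refine (summable_pow_mul_exp_neg hs (neg_pos.mpr hτ) p).congr fun k => ?_
  simp [expWeight]

theorem summable_pow_mul_norm {s τ C : ℝ} (hs : 0 < s) (hτ : 0 < τ) {a : Freq → ℂ}
    (ha : ∀ k, ‖a k‖ ≤ C * expWeight s (-τ) k) (p : ℕ) :
    Summable fun k : Freq => (1 + freqAbs k) ^ p * ‖a k‖ := by
  refine Summable.of_nonneg_of_le (fun k => ?_) (fun k => ?_)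
    ((summable_pow_mul_expWeight hs (neg_lt_zero.mpr hτ) p).mul_left C)
  · have := freqAbs_nonneg k; positivity
  · have := freqAbs_nonneg k
    calc _ ≤ (1 + freqAbs k) ^ p * (C * expWeight s (-τ) k) := by gcongr; exact ha k
      _ = _ := by ring

/-- A single term of the series is at most the square of the norm, and `|k|^(2r) ≥ 1`. The norm does
not see `k = 0`, where the zero mean is used instead. -/
theorem norm_fourierCoef_le {s r τ : ℝ} (hr : 0 ≤ r) {f : Space → ℝ}
    (hf : ∫ x in cell, f x = 0) {C : ℝ≥0} (hC : gevreyNorm s r τ f ≤ C) (k : Freq) :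
    ‖fourierCoef f k‖ ≤ C * expWeight s (-τ) k := by
  by_cases hk : k = 0
  · rw [hk, fourierCoef_zero hf, norm_zero]
    exact mul_nonneg C.2 (expWeight_pos _ _ _).le
  have h1 : ∑' k : {k : Freq // k ≠ 0}, ENNReal.ofReal (freqAbs k ^ (2 * r) *
      Real.exp (2 * τ * freqAbs k ^ (1 / s)) * ‖fourierCoef f k‖ ^ 2) ≤ (C : ℝ≥0∞) ^ 2 := by
    have := ENNReal.rpow_le_rpow hC (z := 2) (by norm_num)
    rw [gevreyNorm, ← ENNReal.rpow_mul] at this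
    simpa using this
  have h2 := (ENNReal.le_tsum (⟨k, hk⟩ : {k : Freq // k ≠ 0})).trans h1
  rw [← ENNReal.ofReal_coe_nnreal, ← ENNReal.ofReal_pow C.coe_nonneg,
    ENNReal.ofReal_le_ofReal_iff (by positivity)] at h2
  have h3 : 1 ≤ freqAbs k ^ (2 * r) := Real.one_le_rpow (one_le_freqAbs hk) (by linarith)
  have h4 : Real.exp (2 * τ * freqAbs k ^ (1 / s)) = expWeight s τ k ^ 2 := by
    rw [expWeight, ← Real.exp_nat_mul]; congr 1; push_cast; ring
  have h5 : (expWeight s τ k * ‖fourierCoef f k‖) ^ 2 ≤ (C : ℝ) ^ 2 := by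
    refine le_trans ?_ h2
    simp only [h4, mul_pow]
    have : 0 ≤ expWeight s τ k ^ 2 * ‖fourierCoef f k‖ ^ 2 := by positivity
    nlinarith
  have h6 := abs_le_of_sq_le_sq' h5 C.2
  have h7 : expWeight s (-τ) k * (expWeight s τ k * ‖fourierCoef f k‖) = ‖fourierCoef f k‖ := by
    rw [← mul_assoc, expWeight_mul]; simp [expWeight]
  rw [← h7, mul_comm]
  exact mul_le_mul_of_nonneg_right h6.2 (expWeight_pos _ _ _).le

/-- Convergence of the Fourier coefficients together with a bound for a larger radius implies
convergence in the Gevrey norm. -/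
theorem tendsto_gevreyNorm_sub {s r τ τ' C : ℝ} (hs : 0 < s) (hττ' : τ < τ') {l : Filter ℝ}
    {F : ℝ → Space → ℝ} {g : Space → ℝ} (hF : ∀ᶠ ν in l, Continuous (F ν)) (hg : Continuous g)
    (hFC : ∀ᶠ ν in l, ∀ k, ‖fourierCoef (F ν) k‖ ≤ C * expWeight s (-τ') k)
    (hgC : ∀ k, ‖fourierCoef g k‖ ≤ C * expWeight s (-τ') k)
    (h : ∀ k, Tendsto (fun ν => fourierCoef (F ν) k) l (𝓝 (fourierCoef g k))) :
    Tendsto (fun ν => gevreyNorm s r τ (F ν - g)) l (𝓝 0) := by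
  obtain ⟨n, hn⟩ := exists_nat_ge (2 * r)
  let t : ℝ → {k : Freq // k ≠ 0} → ℝ := fun ν k => freqAbs k ^ (2 * r) *
      Real.exp (2 * τ * freqAbs k ^ (1 / s)) * ‖fourierCoef (F ν) k - fourierCoef g k‖ ^ 2
  -- The dominating series: the gap `τ' - τ` leaves a decaying exponential that outweighs the factor
  -- `|k|^(2r)`.
  let bd : {k : Freq // k ≠ 0} → ℝ := fun k =>
    (2 * C) ^ 2 * ((1 + freqAbs k) ^ n * expWeight s (2 * (τ - τ')) k)
  have hbd : Summable bd :=
    ((summable_pow_mul_expWeight hs (by linarith) n).comp_injective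
      Subtype.val_injective).mul_left _
  have ht0 : ∀ ν k, 0 ≤ t ν k := fun ν k => by
    have := freqAbs_rpow_nonneg k (2 * r)
    positivity
  have htb : ∀ᶠ ν in l, ∀ k, ‖t ν k‖ ≤ bd k := by
    filter_upwards [hFC] with ν hν k
    rw [Real.norm_of_nonneg (ht0 ν k)]
    have h1 : ‖fourierCoef (F ν) k - fourierCoef g k‖ ≤ 2 * C * expWeight s (-τ') k :=
      (norm_sub_le _ _).trans (by linarith [hν k, hgC k])
    have h2 : freqAbs k ^ (2 * r) ≤ (1 + freqAbs k) ^ n := by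
      have h1 := one_le_freqAbs k.2
      calc freqAbs k ^ (2 * r) ≤ freqAbs k ^ (n : ℝ) :=
            Real.rpow_le_rpow_of_exponent_le h1 hn
        _ = freqAbs k ^ n := Real.rpow_natCast _ _
        _ ≤ _ := by gcongr; linarith
    have h3 : expWeight s (2 * (τ - τ')) k =
        Real.exp (2 * τ * freqAbs k ^ (1 / s)) * expWeight s (-τ') k ^ 2 := by
      simp only [expWeight]
      rw [← Real.exp_nat_mul, ← Real.exp_add]
      congr 1; push_cast; ring
    calc freqAbs k ^ (2 * r) * Real.exp (2 * τ * freqAbs k ^ (1 / s)) *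
          ‖fourierCoef (F ν) k - fourierCoef g k‖ ^ 2 ≤ (1 + freqAbs k) ^ n * Real.exp (2 * τ * freqAbs k ^ (1 / s)) *
          (2 * C * expWeight s (-τ') k) ^ 2 := by
          have := freqAbs_rpow_nonneg k (2 * r)
          have := freqAbs_nonneg k
          gcongr
      _ = bd k := by simp only [bd, h3]; ring
  have htl : ∀ k, Tendsto (fun ν => t ν k) l (𝓝 0) := fun k => by
    have h1 : Tendsto (fun ν => ‖fourierCoef (F ν) k - fourierCoef g k‖) l (𝓝 0) :=
      tendsto_iff_norm_sub_tendsto_zero.mp (h k)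
    simpa [t] using (h1.pow 2).const_mul
      (freqAbs k ^ (2 * r) * Real.exp (2 * τ * freqAbs k ^ (1 / s)))
  have h1 := tendsto_tsum_of_dominated_convergence hbd htl htb
  rw [tsum_zero] at h1
  have h2 := ((ENNReal.continuous_rpow_const (y := 1 / 2)).tendsto _).comp
    ((ENNReal.continuous_ofReal.tendsto _).comp h1)
  have h3 : (ENNReal.ofReal 0) ^ (1 / 2 : ℝ) = 0 := by simp
  rw [h3] at h2
  refine h2.congr' ?_
  filter_upwards [hF, htb] with ν hν hνb
  simp only [Function.comp_apply, gevreyNorm]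
  rw [ENNReal.ofReal_tsum_of_nonneg (ht0 ν) (Summable.of_norm_bounded hbd hνb)]
  simp only [t, fourierCoef_sub hν hg]

/-! ### Series for the gradient and the velocity. -/

/-- Absolute convergence of a trigonometric series together with its first derivatives. -/
def AbsSummable (a : Freq → ℂ) : Prop := Summable fun k => (1 + freqAbs k) * ‖a k‖

theorem AbsSummable.summable_freqAbs {a : Freq → ℂ} (h : AbsSummable a) :
    Summable fun k => freqAbs k * ‖a k‖ :=
  Summable.of_nonneg_of_le (fun k => mul_nonneg (freqAbs_nonneg k) (norm_nonneg _))
    (fun k => by gcongr; linarith) h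

theorem AbsSummable.summable {a : Freq → ℂ} (h : AbsSummable a) : Summable a :=
  Summable.of_norm_bounded h fun k => by
    nlinarith [freqAbs_nonneg k, norm_nonneg (a k), mul_nonneg (freqAbs_nonneg k) (norm_nonneg (a k))]

theorem absSummable_of_expBound {s τ C : ℝ} (hs : 0 < s) (hτ : 0 < τ) {a : Freq → ℂ}
    (ha : ∀ k, ‖a k‖ ≤ C * expWeight s (-τ) k) : AbsSummable a :=
  (summable_pow_mul_norm hs hτ ha 1).congr fun k => by rw [pow_one]

theorem AbsSummable.mul_mode_of_norm_le {a b : Freq → ℂ} (ha : AbsSummable a) {c : ℝ}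
    (hb : ∀ k, ‖b k‖ ≤ c * freqAbs k) (x : Space) :
    Summable fun k => b k * a k * mode k x := by
  refine Summable.of_norm_bounded (ha.summable_freqAbs.mul_left c) fun k => ?_
  rw [norm_mul, norm_mode, mul_one, norm_mul, ← mul_assoc]
  exact mul_le_mul_of_nonneg_right (hb k) (norm_nonneg _)

theorem norm_I_mul_freq_le (k : Freq) (j : Fin 3) : ‖Complex.I * (k j : ℂ)‖ ≤ 1 * freqAbs k := by
  rw [norm_mul, Complex.norm_I, one_mul, one_mul, Complex.norm_intCast]
  exact abs_le_freqAbs k j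

/-- The derivative of `mode k`. -/
noncomputable def modeDeriv (k : Freq) : Space →L[ℝ] ℂ :=
  ∑ i, (ContinuousLinearMap.proj (R := ℝ) (φ := fun _ : Fin 3 => ℝ) i).smulRight
    (Complex.I * (k i : ℂ))

theorem modeDeriv_apply (k : Freq) (v : Space) :
    modeDeriv k v = ∑ i, (v i : ℂ) * (Complex.I * (k i : ℂ)) := by
  simp [modeDeriv]

theorem norm_modeDeriv_le (k : Freq) : ‖modeDeriv k‖ ≤ 3 * freqAbs k := by
  refine ContinuousLinearMap.opNorm_le_bound _ (by have := freqAbs_nonneg k; positivity) fun v => ?_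
  rw [modeDeriv_apply]
  refine (norm_sum_le _ _).trans ?_
  have : ∀ i ∈ Finset.univ, ‖(v i : ℂ) * (Complex.I * (k i : ℂ))‖ ≤ ‖v‖ * freqAbs k := fun i _ => by
    rw [norm_mul, Complex.norm_real]
    have := norm_I_mul_freq_le k i
    rw [one_mul] at this
    exact mul_le_mul (norm_le_pi_norm v i) this (norm_nonneg _) (norm_nonneg _)
  refine (Finset.sum_le_card_nsmul _ _ _ this).trans (le_of_eq ?_)
  simp; ring

theorem hasFDerivAt_mode (k : Freq) (x : Space) :
    HasFDerivAt (mode k) (mode k x • modeDeriv k) x := by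
  have h1 : ∀ i, HasFDerivAt (fun x : Space => ((x i : ℝ) : ℂ) * (Complex.I * (k i : ℂ)))
      ((ContinuousLinearMap.proj (R := ℝ) (φ := fun _ : Fin 3 => ℝ) i).smulRight
        (Complex.I * (k i : ℂ))) x := fun i => by
    have := ((ContinuousLinearMap.proj (R := ℝ) (φ := fun _ : Fin 3 => ℝ) i).smulRight
      (Complex.I * (k i : ℂ))).hasFDerivAt (x := x)
    refine this.congr_of_eventuallyEq (Eventually.of_forall fun y => ?_)
    simp
  have h2 := (HasFDerivAt.fun_sum (u := Finset.univ) fun i _ => h1 i).cexp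
  have h3 : (fun x : Space => Complex.exp (∑ i, ((x i : ℝ) : ℂ) * (Complex.I * (k i : ℂ)))) =
      mode k := by
    ext y
    simp only [mode]
    congr 1
    push_cast
    rw [Finset.mul_sum]
    exact Finset.sum_congr rfl fun i _ => by ring
  rw [← h3]
  exact h2

theorem hasFDerivAt_of_hasSum {f : Space → ℝ} {a : Freq → ℂ} (ha : AbsSummable a)
    (h : ∀ x, HasSum (fun k => a k * mode k x) (f x)) (x : Space) :
    HasFDerivAt (fun x => (f x : ℂ)) (∑' k, a k • mode k x • modeDeriv k) x := by
  have h1 : (fun x => (f x : ℂ)) = fun x => ∑' k, a k * mode k x :=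
    funext fun x => (h x).tsum_eq.symm
  rw [h1]
  refine hasFDerivAt_tsum (ha.summable_freqAbs.mul_left 3)
    (fun k x => (hasFDerivAt_mode k x).const_mul (a k)) (fun k x => ?_) (h x).summable x
  rw [norm_smul, norm_smul, norm_mode, one_mul]
  nlinarith [norm_modeDeriv_le k, norm_nonneg (a k)]

theorem hasSum_fderiv {f : Space → ℝ} {a : Freq → ℂ} (ha : AbsSummable a)
    (h : ∀ x, HasSum (fun k => a k * mode k x) (f x)) (j : Fin 3) (x : Space) :
    HasSum (fun k => Complex.I * (k j : ℂ) * a k * mode k x)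
      ((fderiv ℝ f x (Pi.single j 1) : ℝ) : ℂ) := by
  have h1 := hasFDerivAt_of_hasSum ha h x
  have h2 : HasFDerivAt f (Complex.reCLM.comp (∑' k, a k • mode k x • modeDeriv k)) x :=
    Complex.reCLM.hasFDerivAt.comp x h1
  have h3 : HasFDerivAt (fun x => (f x : ℂ)) (Complex.ofRealCLM.comp (fderiv ℝ f x)) x :=
    Complex.ofRealCLM.hasFDerivAt.comp x h2.differentiableAt.hasFDerivAt
  have h4 : ((fderiv ℝ f x (Pi.single j 1) : ℝ) : ℂ) =
      (∑' k, a k • mode k x • modeDeriv k) (Pi.single j 1) := by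
    rw [← h3.unique h1]; simp
  have hs : Summable fun k => a k • mode k x • modeDeriv k := by
    refine Summable.of_norm_bounded (ha.summable_freqAbs.mul_left 3) fun k => ?_
    rw [norm_smul, norm_smul, norm_mode, one_mul]
    nlinarith [norm_modeDeriv_le k, norm_nonneg (a k)]
  rw [h4]
  have h5 := (ContinuousLinearMap.apply ℝ ℂ (Pi.single j 1 : Space)).hasSum hs.hasSum
  refine h5.congr_fun fun k => ?_
  have h6 : modeDeriv k (Pi.single j 1) = Complex.I * (k j : ℂ) := by
    rw [modeDeriv_apply, Finset.sum_eq_single j (fun i _ hi => by simp [hi]) (by simp)]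
    simp
  simp only [ContinuousLinearMap.apply_apply, smul_apply, h6, smul_eq_mul]
  ring

/-- The symbol is real and even and the coefficients of a real function are conjugate-symmetric, so
the series is invariant under conjugation and the real part in `velocity` discards nothing. -/
theorem hasSum_velocity {ν : ℝ} (hν : 0 ≤ ν) {f : Space → ℝ} (ha : AbsSummable (fourierCoef f))
    (j : Fin 3) (x : Space) :
    HasSum (fun k => (symbolM ν k j : ℂ) * fourierCoef f k * mode k x)
      ((velocity ν f j x : ℝ) : ℂ) := by
  have hs : Summable fun k => (symbolM ν k j : ℂ) * fourierCoef f k * mode k x :=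
    ha.mul_mode_of_norm_le (c := 2) (fun k => by
      rw [Complex.norm_real]; exact abs_symbolM_le hν k j) x
  have h1 := hs.hasSum
  have h2 : (starRingEnd ℂ) (∑' k, (symbolM ν k j : ℂ) * fourierCoef f k * mode k x) =
      ∑' k, (symbolM ν k j : ℂ) * fourierCoef f k * mode k x := by
    rw [Complex.conj_tsum, ← (Equiv.neg Freq).tsum_eq]
    refine tsum_congr fun k => ?_
    simp [symbolM_neg, fourierCoef_neg, mode_neg]
  rw [velocity, Complex.conj_eq_iff_re.mp h2]
  exact h1

theorem abs_velocity_le {ν : ℝ} (hν : 0 ≤ ν) {f : Space → ℝ} (ha : AbsSummable (fourierCoef f))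
    (j : Fin 3) (x : Space) :
    |velocity ν f j x| ≤ 2 * ∑' k, freqAbs k * ‖fourierCoef f k‖ := by
  rw [← Real.norm_eq_abs, ← Complex.norm_real, ← (hasSum_velocity hν ha j x).tsum_eq, ← tsum_mul_left]
  refine tsum_of_norm_bounded (ha.summable_freqAbs.mul_left 2).hasSum fun k => ?_
  rw [norm_mul, norm_mul, norm_mode, mul_one, Complex.norm_real, ← mul_assoc]
  exact mul_le_mul_of_nonneg_right (abs_symbolM_le hν k j) (norm_nonneg _)

theorem abs_fderiv_le {f : Space → ℝ} {a : Freq → ℂ} (ha : AbsSummable a)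
    (h : ∀ x, HasSum (fun k => a k * mode k x) (f x)) (j : Fin 3) (x : Space) :
    |fderiv ℝ f x (Pi.single j 1)| ≤ ∑' k, freqAbs k * ‖a k‖ := by
  rw [← Real.norm_eq_abs, ← Complex.norm_real, ← (hasSum_fderiv ha h j x).tsum_eq]
  refine tsum_of_norm_bounded ha.summable_freqAbs.hasSum fun k => ?_
  rw [norm_mul, norm_mul, norm_mode, mul_one]
  have := norm_I_mul_freq_le k j
  rw [one_mul] at this
  exact mul_le_mul_of_nonneg_right this (norm_nonneg _)

/-! ### Bounds and continuity of the advection term. -/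

/-- A periodic function with the zero mean and exponentially decaying Fourier coefficients, in the
quantitative form that is used for a priori estimates. -/
structure ExpDecay (s τ C : ℝ) (f : Space → ℝ) : Prop where
  continuous : Continuous f
  bound : ∀ k, ‖fourierCoef f k‖ ≤ C * expWeight s (-τ) k
  hasSum : ∀ x, HasSum (fun k => fourierCoef f k * mode k x) (f x)

theorem IsGevrey.expDecay {s r τ : ℝ} (hs : 0 < s) (hr : 0 ≤ r) (hτ : 0 < τ) {f : Space → ℝ}
    (hf : IsGevrey s r τ f) {C : ℝ≥0} (hC : gevreyNorm s r τ f ≤ C) : ExpDecay s τ C f where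
  continuous := hf.continuous
  bound := norm_fourierCoef_le hr hf.mean_zero hC
  hasSum := hasSum_fourierCoef_mul_mode hf.continuous hf.periodic
    (absSummable_of_expBound hs hτ (norm_fourierCoef_le hr hf.mean_zero hC)).summable

theorem IsGevrey.exists_expDecay {s r τ : ℝ} (hs : 0 < s) (hr : 0 ≤ r) (hτ : 0 < τ)
    {f : Space → ℝ} (hf : IsGevrey s r τ f) : ∃ C : ℝ≥0, ExpDecay s τ C f :=
  ⟨(gevreyNorm s r τ f).toNNReal,
    hf.expDecay hs hr hτ (ENNReal.coe_toNNReal hf.norm_lt_top.ne).ge⟩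

theorem ExpDecay.absSummable {s τ C : ℝ} (hs : 0 < s) (hτ : 0 < τ) {f : Space → ℝ}
    (hf : ExpDecay s τ C f) : AbsSummable (fourierCoef f) :=
  absSummable_of_expBound hs hτ hf.bound

/-- The sum of the weights `(1 + |k|) exp(-τ |k|^{1/s})`. -/
noncomputable def weightSum (s τ : ℝ) : ℝ := ∑' k : Freq, (1 + freqAbs k) * expWeight s (-τ) k

theorem weightSum_nonneg (s τ : ℝ) : 0 ≤ weightSum s τ :=
  tsum_nonneg fun k => mul_nonneg (by have := freqAbs_nonneg k; positivity) (expWeight_pos _ _ _).le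

theorem summable_weight {s τ : ℝ} (hs : 0 < s) (hτ : 0 < τ) :
    Summable fun k : Freq => (1 + freqAbs k) * expWeight s (-τ) k := by
  simpa using summable_pow_mul_expWeight hs (neg_lt_zero.mpr hτ) 1

theorem tsum_freqAbs_mul_norm_le {s τ C : ℝ} (hs : 0 < s) (hτ : 0 < τ) (hC : 0 ≤ C)
    {a : Freq → ℂ} (ha : ∀ k, ‖a k‖ ≤ C * expWeight s (-τ) k) :
    ∑' k, freqAbs k * ‖a k‖ ≤ C * weightSum s τ := by
  rw [weightSum, ← tsum_mul_left]
  refine (absSummable_of_expBound hs hτ ha).summable_freqAbs.tsum_le_tsum (fun k => ?_)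
    ((summable_weight hs hτ).mul_left C)
  have h1 := freqAbs_nonneg k
  have h2 := mul_nonneg hC (expWeight_pos s (-τ) k).le
  nlinarith [ha k, mul_le_mul_of_nonneg_left (ha k) h1]

/-- Interpolation between a uniform bound and an exponentially decaying bound. -/
theorem norm_le_sqrt_mul_expWeight {s τ C D : ℝ} (hC : 0 ≤ C) (hD : 0 ≤ D) {a : Freq → ℂ}
    (ha : ∀ k, ‖a k‖ ≤ C * expWeight s (-τ) k) (haD : ∀ k, ‖a k‖ ≤ D) (k : Freq) :
    ‖a k‖ ≤ (√C * √D) * expWeight s (-(τ / 2)) k := by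
  have hw := expWeight_pos s (-(τ / 2)) k
  refine (le_abs_self _).trans (abs_le_of_sq_le_sq ?_ (by positivity))
  have h1 : expWeight s (-(τ / 2)) k ^ 2 = expWeight s (-τ) k := by
    rw [sq, expWeight_mul]; congr 1; ring
  rw [mul_pow, mul_pow, h1, Real.sq_sqrt hC, Real.sq_sqrt hD, sq]
  calc ‖a k‖ * ‖a k‖ ≤ C * expWeight s (-τ) k * D :=
        mul_le_mul (ha k) (haD k) (norm_nonneg _) ((norm_nonneg _).trans (ha k))
    _ = _ := by ring

theorem abs_advection_le {ν : ℝ} (hν : 0 ≤ ν) {s τ C : ℝ} (hs : 0 < s) (hτ : 0 < τ) (hC : 0 ≤ C)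
    {f : Space → ℝ} (hf : ExpDecay s τ C f) (x : Space) :
    |advection ν f x| ≤ 6 * (C * weightSum s τ) ^ 2 := by
  have ha := hf.absSummable hs hτ
  have hle := tsum_freqAbs_mul_norm_le hs hτ hC hf.bound
  have h0 : 0 ≤ C * weightSum s τ := mul_nonneg hC (weightSum_nonneg _ _)
  have h1 : ∀ j ∈ Finset.univ, |velocity ν f j x * fderiv ℝ f x (Pi.single j 1)| ≤
      2 * (C * weightSum s τ) * (C * weightSum s τ) := fun j _ => by
    rw [abs_mul]
    exact mul_le_mul ((abs_velocity_le hν ha j x).trans (by linarith))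
      ((abs_fderiv_le ha hf.hasSum j x).trans hle) (abs_nonneg _) (by positivity)
  refine (Finset.abs_sum_le_sum_abs _ _).trans ((Finset.sum_le_card_nsmul _ _ _ h1).trans ?_)
  simp; nlinarith

/-- The usual splitting of a difference of products. The difference of the coefficients has its own
radius `τ'`, because interpolation in time will provide smallness only at half the radius. -/
theorem abs_advection_sub_le {ν : ℝ} (hν : 0 ≤ ν) {s τ C : ℝ} (hs : 0 < s) (hτ : 0 < τ)
    (hC : 0 ≤ C) {f g : Space → ℝ} (hf : ExpDecay s τ C f) (hg : ExpDecay s τ C g)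
    {τ' D : ℝ} (hτ' : 0 < τ') (hD : 0 ≤ D)
    (hfg : ∀ k, ‖fourierCoef f k - fourierCoef g k‖ ≤ D * expWeight s (-τ') k) (x : Space) :
    |advection ν f x - advection ν g x| ≤ 12 * (C * weightSum s τ) * (D * weightSum s τ') := by
  have haf := hf.absSummable hs hτ
  have hag := hg.absSummable hs hτ
  have hd : AbsSummable fun k => fourierCoef f k - fourierCoef g k :=
    absSummable_of_expBound hs hτ' hfg
  have hlef := tsum_freqAbs_mul_norm_le hs hτ hC hf.bound
  have hleg := tsum_freqAbs_mul_norm_le hs hτ hC hg.bound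
  have hled := tsum_freqAbs_mul_norm_le hs hτ' hD hfg
  have h0 : 0 ≤ C * weightSum s τ := mul_nonneg hC (weightSum_nonneg _ _)
  have h0' : 0 ≤ D * weightSum s τ' := mul_nonneg hD (weightSum_nonneg _ _)
  have hv : ∀ j, |velocity ν f j x - velocity ν g j x| ≤ 2 * (D * weightSum s τ') := fun j => by
    have := (hasSum_velocity hν haf j x).sub (hasSum_velocity hν hag j x)
    rw [← Real.norm_eq_abs, ← Complex.norm_real, Complex.ofReal_sub, ← this.tsum_eq]
    refine (tsum_of_norm_bounded (hd.summable_freqAbs.mul_left 2).hasSum fun k => ?_).trans ?_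
    · rw [← sub_mul, ← mul_sub, norm_mul, norm_mul, norm_mode, mul_one, Complex.norm_real,
        ← mul_assoc]
      exact mul_le_mul_of_nonneg_right (abs_symbolM_le hν k j) (norm_nonneg _)
    · rw [tsum_mul_left]; linarith
  have hp : ∀ j, |fderiv ℝ f x (Pi.single j 1) - fderiv ℝ g x (Pi.single j 1)| ≤
      D * weightSum s τ' := fun j => by
    have := (hasSum_fderiv haf hf.hasSum j x).sub (hasSum_fderiv hag hg.hasSum j x)
    rw [← Real.norm_eq_abs, ← Complex.norm_real, Complex.ofReal_sub, ← this.tsum_eq]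
    refine (tsum_of_norm_bounded hd.summable_freqAbs.hasSum fun k => ?_).trans hled
    rw [← sub_mul, ← mul_sub, norm_mul, norm_mul, norm_mode, mul_one]
    have := norm_I_mul_freq_le k j
    rw [one_mul] at this
    exact mul_le_mul_of_nonneg_right this (norm_nonneg _)
  have h1 : ∀ j ∈ Finset.univ, |velocity ν f j x * fderiv ℝ f x (Pi.single j 1) -
      velocity ν g j x * fderiv ℝ g x (Pi.single j 1)| ≤
      4 * (C * weightSum s τ) * (D * weightSum s τ') := fun j _ => by
    have e : velocity ν f j x * fderiv ℝ f x (Pi.single j 1) -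
        velocity ν g j x * fderiv ℝ g x (Pi.single j 1) =
        (velocity ν f j x - velocity ν g j x) * fderiv ℝ f x (Pi.single j 1) +
        velocity ν g j x * (fderiv ℝ f x (Pi.single j 1) - fderiv ℝ g x (Pi.single j 1)) := by ring
    rw [e]
    refine (abs_add_le _ _).trans ?_
    rw [abs_mul, abs_mul]
    have e1 := mul_le_mul (hv j) ((abs_fderiv_le haf hf.hasSum j x).trans hlef) (abs_nonneg _)
      (by positivity)
    have e2 := mul_le_mul ((abs_velocity_le hν hag j x).trans
      (mul_le_mul_of_nonneg_left hleg zero_le_two)) (hp j) (abs_nonneg _) (by positivity)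
    nlinarith
  rw [advection, advection, ← Finset.sum_sub_distrib]
  refine (Finset.abs_sum_le_sum_abs _ _).trans ((Finset.sum_le_card_nsmul _ _ _ h1).trans ?_)
  simp; nlinarith

/-- Symbol and coefficients vary together; the `ν`-independent bound `2|k|` on the symbol provides
the summable majorant. -/
theorem tendsto_advection {s τ C : ℝ} (hs : 0 < s) (hτ : 0 < τ) {l : Filter ℝ}
    (hl : l ≤ 𝓝[>] 0) {F : ℝ → Space → ℝ} {g : Space → ℝ}
    (hF : ∀ᶠ ν in l, ExpDecay s τ C (F ν)) (hg : ExpDecay s τ C g)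
    (h : ∀ k, Tendsto (fun ν => fourierCoef (F ν) k) l (𝓝 (fourierCoef g k))) (x : Space) :
    Tendsto (fun ν => advection ν (F ν) x) l (𝓝 (advection 0 g x)) := by
  have hpos : ∀ᶠ ν in l, 0 < ν := hl self_mem_nhdsWithin
  have hl0 : l ≤ 𝓝 0 := hl.trans nhdsWithin_le_nhds
  have hbd : Summable fun k : Freq => C * ((1 + freqAbs k) * expWeight s (-τ) k) :=
    (summable_weight hs hτ).mul_left C
  have hle : ∀ {a : ℂ} (k : Freq), ‖a‖ ≤ C * expWeight s (-τ) k →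
      freqAbs k * ‖a‖ ≤ C * ((1 + freqAbs k) * expWeight s (-τ) k) := fun k ha => by
    have h1 := freqAbs_nonneg k
    nlinarith [mul_le_mul_of_nonneg_left ha h1, norm_nonneg (fourierCoef g k), hg.bound k]
  refine tendsto_finsetSum _ fun j _ => Tendsto.mul ?_ ?_
  · have h1 : Tendsto (fun ν => ∑' k, (symbolM ν k j : ℂ) * fourierCoef (F ν) k * mode k x) l
        (𝓝 (∑' k, (symbolM 0 k j : ℂ) * fourierCoef g k * mode k x)) := by
      refine tendsto_tsum_of_dominated_convergence (hbd.mul_left 2) (fun k => ?_) ?_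
      · exact (((Complex.continuous_ofReal.tendsto _).comp
          ((tendsto_symbolM k j).mono_left hl0)).mul (h k)).mul_const _
      · filter_upwards [hF, hpos] with ν hν hν0 k
        rw [norm_mul, norm_mul, norm_mode, mul_one, Complex.norm_real]
        refine le_trans (mul_le_mul_of_nonneg_right (abs_symbolM_le hν0.le k j) (norm_nonneg _)) ?_
        rw [mul_assoc]
        exact mul_le_mul_of_nonneg_left (hle k (hν.bound k)) zero_le_two
    exact (Complex.continuous_re.tendsto _).comp h1
  · have h1 : Tendsto (fun ν => ∑' k, Complex.I * (k j : ℂ) * fourierCoef (F ν) k * mode k x) l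
        (𝓝 (∑' k, Complex.I * (k j : ℂ) * fourierCoef g k * mode k x)) := by
      refine tendsto_tsum_of_dominated_convergence hbd (fun k => ?_) ?_
      · exact ((h k).const_mul _).mul_const _
      · filter_upwards [hF] with ν hν k
        rw [norm_mul, norm_mul, norm_mode, mul_one]
        have := norm_I_mul_freq_le k j
        rw [one_mul] at this
        exact le_trans (mul_le_mul_of_nonneg_right this (norm_nonneg _)) (hle k (hν.bound k))
    have h2 := (Complex.continuous_re.tendsto _).comp h1
    rw [(hasSum_fderiv (hg.absSummable hs hτ) hg.hasSum j x).tsum_eq, Complex.ofReal_re] at h2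
    refine h2.congr' ?_
    filter_upwards [hF] with ν hν
    rw [Function.comp_apply, (hasSum_fderiv (hν.absSummable hs hτ) hν.hasSum j x).tsum_eq,
      Complex.ofReal_re]

/-! ### Regularity in time, uniformly in the viscosity. -/

/-- A family of functions with uniformly decaying coefficients which solves the equation. -/
structure DecaySolution (s τ T C ν : ℝ) (S : Space → ℝ) (θ : ℝ → Space → ℝ) : Prop where
  decay : ∀ t ∈ Icc 0 T, ExpDecay s τ C (θ t)
  equation : ∀ t ∈ Icc 0 T, ∀ x,
    HasDerivWithinAt (fun t' => θ t' x) (S x - advection ν (θ t) x) (Icc 0 T) t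

theorem IsGevreySolution.decaySolution {s r τ T ν : ℝ} (hs : 0 < s) (hr : 0 ≤ r) (hτ : 0 < τ)
    {S θ₀ : Space → ℝ} {θ : ℝ → Space → ℝ} (h : IsGevreySolution s r τ T ν S θ₀ θ) {C : ℝ≥0}
    (hC : ∀ t ∈ Icc 0 T, gevreyNorm s r τ (θ t) ≤ C) : DecaySolution s τ T C ν S θ where
  decay t ht := (h.gevrey t ht).expDecay hs hr hτ (hC t ht)
  equation := h.equation

section

variable {s τ T C ν B : ℝ} {S : Space → ℝ} {θ : ℝ → Space → ℝ}

theorem DecaySolution.abs_rhs_le (h : DecaySolution s τ T C ν S θ) (hs : 0 < s) (hτ : 0 < τ)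
    (hC : 0 ≤ C) (hν : 0 ≤ ν) (hB : ∀ x, |S x| ≤ B) {t : ℝ} (ht : t ∈ Icc 0 T) (x : Space) :
    |S x - advection ν (θ t) x| ≤ B + 6 * (C * weightSum s τ) ^ 2 :=
  (abs_sub _ _).trans (add_le_add (hB x) (abs_advection_le hν hs hτ hC (h.decay t ht) x))

theorem DecaySolution.abs_sub_le (h : DecaySolution s τ T C ν S θ) (hs : 0 < s) (hτ : 0 < τ)
    (hC : 0 ≤ C) (hν : 0 ≤ ν) (hB : ∀ x, |S x| ≤ B) {t t' : ℝ} (ht : t ∈ Icc 0 T)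
    (ht' : t' ∈ Icc 0 T) (x : Space) :
    |θ t' x - θ t x| ≤ (B + 6 * (C * weightSum s τ) ^ 2) * |t' - t| :=
  (convex_Icc 0 T).norm_image_sub_le_of_norm_hasDerivWithin_le
    (fun u hu => h.equation u hu x) (fun _ hu => h.abs_rhs_le hs hτ hC hν hB hu x) ht ht'

theorem DecaySolution.norm_fourierCoef_sub_le (h : DecaySolution s τ T C ν S θ) (hs : 0 < s)
    (hτ : 0 < τ) (hC : 0 ≤ C) (hν : 0 ≤ ν) (hB : ∀ x, |S x| ≤ B) {t t' : ℝ} (ht : t ∈ Icc 0 T)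
    (ht' : t' ∈ Icc 0 T) (k : Freq) :
    ‖fourierCoef (θ t') k - fourierCoef (θ t) k‖ ≤
      (B + 6 * (C * weightSum s τ) ^ 2) * |t' - t| := by
  rw [← fourierCoef_sub (h.decay t' ht').continuous (h.decay t ht).continuous]
  exact norm_fourierCoef_le_of_abs_le (fun x => h.abs_sub_le hs hτ hC hν hB ht ht' x) k

/-- The right-hand side of the equation is Hölder continuous in time, with a constant that does
not depend on the viscosity. -/
theorem DecaySolution.exists_holder (hs : 0 < s) (hτ : 0 < τ) (hC : 0 ≤ C) (hB0 : 0 ≤ B)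
    (hB : ∀ x, |S x| ≤ B) :
    ∃ L : ℝ, 0 ≤ L ∧ ∀ (ν : ℝ) (θ : ℝ → Space → ℝ), 0 ≤ ν → DecaySolution s τ T C ν S θ →
      ∀ t ∈ Icc 0 T, ∀ t' ∈ Icc 0 T, ∀ x,
        |advection ν (θ t') x - advection ν (θ t) x| ≤ L * √|t' - t| := by
  set A := B + 6 * (C * weightSum s τ) ^ 2 with hA
  have hA0 : 0 ≤ A := by positivity
  have hW := weightSum_nonneg s τ
  have hW2 := weightSum_nonneg s (τ / 2)
  refine ⟨12 * (C * weightSum s τ) * (√(2 * C) * √A * weightSum s (τ / 2)), by positivity, ?_⟩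
  intro ν θ hν h t ht t' ht' x
  -- The increment of the coefficients is Lipschitz in time without decay in `k`, and bounded with
  -- decay at radius `τ`. The geometric mean of the two bounds has radius `τ / 2` and size `√|t' -
  -- t|`.
  have h1 := abs_advection_sub_le hν hs hτ hC (h.decay t' ht') (h.decay t ht) (half_pos hτ)
    (D := √(2 * C) * √(A * |t' - t|)) (by positivity)
    (norm_le_sqrt_mul_expWeight (by positivity) (by positivity) (fun k => ?_)
      (h.norm_fourierCoef_sub_le hs hτ hC hν hB ht ht')) x
  · rw [Real.sqrt_mul hA0] at h1
    linarith
  · exact (norm_sub_le _ _).trans (by linarith [(h.decay t ht).bound k, (h.decay t' ht').bound k])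

end

/-- The conclusion involves no derivative, so it is stable under pointwise limits in `ν` and under
integration in `x`; `hasDerivWithinAt_of_norm_taylor_le` then recovers differentiability. -/
theorem abs_taylor_le_of_holder {F G : ℝ → ℝ} {T L : ℝ} (hL : 0 ≤ L)
    (hF : ∀ t ∈ Icc 0 T, HasDerivWithinAt F (G t) (Icc 0 T) t)
    (hG : ∀ t ∈ Icc 0 T, ∀ t' ∈ Icc 0 T, |G t' - G t| ≤ L * √|t' - t|) {t₀ t : ℝ}
    (ht₀ : t₀ ∈ Icc 0 T) (ht : t ∈ Icc 0 T) :
    |F t - F t₀ - (t - t₀) * G t₀| ≤ L * √|t - t₀| * |t - t₀| := by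
  have hsub : uIcc t₀ t ⊆ Icc 0 T := (convex_Icc 0 T).ordConnected.uIcc_subset ht₀ ht
  have h1 := (convex_uIcc t₀ t).norm_image_sub_le_of_norm_hasDerivWithin_le
    (f := fun u => F u - u * G t₀) (f' := fun u => G u - 1 * G t₀) (C := L * √|t - t₀|)
    (fun u hu => ((hF u (hsub hu)).mono hsub).sub ((hasDerivWithinAt_id u _).mul_const _))
    (fun u hu => ?_) left_mem_uIcc right_mem_uIcc
  · rw [Real.norm_eq_abs, Real.norm_eq_abs] at h1
    convert h1 using 2
    ring
  · rw [one_mul]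
    refine (hG t₀ ht₀ u (hsub hu)).trans ?_
    exact mul_le_mul_of_nonneg_left (Real.sqrt_le_sqrt (abs_sub_left_of_mem_uIcc hu)) hL

theorem hasDerivWithinAt_of_norm_taylor_le {E : Type*} [NormedAddCommGroup E] [NormedSpace ℝ E]
    {F : ℝ → E} {g : E} {L t₀ : ℝ} {I : Set ℝ}
    (h : ∀ t ∈ I, ‖F t - F t₀ - (t - t₀) • g‖ ≤ L * √|t - t₀| * |t - t₀|) :
    HasDerivWithinAt F g I t₀ := by
  rw [hasDerivWithinAt_iff_isLittleO, Asymptotics.isLittleO_iff]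
  intro c hc
  have hlim : Tendsto (fun t => L * √|t - t₀|) (𝓝[I] t₀) (𝓝 0) := by
    have : Continuous fun t => L * √|t - t₀| := by fun_prop
    have := this.tendsto t₀
    simp only [sub_self, abs_zero, Real.sqrt_zero, mul_zero] at this
    exact this.mono_left nhdsWithin_le_nhds
  filter_upwards [hlim.eventually (ge_mem_nhds hc), self_mem_nhdsWithin] with t ht htI
  exact (h t htI).trans (mul_le_mul_of_nonneg_right ht (abs_nonneg _))

/-! ### Compactness: limits of uniformly bounded solutions. -/

theorem periodic_mode (k : Freq) (i : Fin 3) :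
    Function.Periodic (mode k) (Pi.single i (2 * Real.pi)) := by
  intro x
  have h1 : ((∑ j, (k j : ℝ) * (x + Pi.single i (2 * Real.pi) : Space) j : ℝ) : ℂ) =
      ((∑ j, (k j : ℝ) * x j : ℝ) : ℂ) + k i * (2 * Real.pi) := by
    rw [← Complex.ofReal_intCast]
    norm_cast
    simp only [Pi.add_apply, mul_add, Finset.sum_add_distrib]
    congr 1
    rw [Finset.sum_eq_single i (fun j _ hj => by simp [hj]) (by simp)]
    simp
  rw [mode, h1, mul_add, Complex.exp_add]
  have h2 : Complex.I * ((k i : ℂ) * (2 * Real.pi)) = k i * (2 * Real.pi * Complex.I) := by ring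
  rw [h2, Complex.exp_int_mul_two_pi_mul_I, mul_one, mode]

theorem continuous_of_hasSum {f : Space → ℝ} {a : Freq → ℂ} (ha : Summable a)
    (h : ∀ x, HasSum (fun k => a k * mode k x) (f x)) : Continuous f := by
  have h1 : Continuous fun x => ∑' k, a k * mode k x :=
    continuous_tsum (fun k => (continuous_mode k).const_mul _) ha.norm fun k x => by
      rw [norm_mul, norm_mode, mul_one]
  refine (Complex.continuous_re.comp h1).congr fun x => ?_
  rw [Function.comp_apply, (h x).tsum_eq, Complex.ofReal_re]

theorem isGevrey_of_hasSum {s r τ C : ℝ} (hs : 0 < s) (hτ : 0 < τ) {f : Space → ℝ}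
    {a : Freq → ℂ} (ha : ∀ k, ‖a k‖ ≤ C * expWeight s (-τ) k) (ha0 : a 0 = 0)
    (h : ∀ x, HasSum (fun k => a k * mode k x) (f x)) (hn : gevreyNorm s r τ f < ∞) :
    IsGevrey s r τ f where
  continuous := continuous_of_hasSum (absSummable_of_expBound hs hτ ha).summable h
  periodic i x := by
    have h1 := h (x + Pi.single i (2 * Real.pi))
    simp only [periodic_mode _ i x] at h1
    exact_mod_cast h1.unique (h x)
  mean_zero := by
    have h1 := fourierCoef_of_hasSum (absSummable_of_expBound hs hτ ha).summable h 0
    rw [ha0] at h1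
    simp only [fourierCoef, neg_zero, mode_zero, mul_one] at h1
    rw [integral_complex_ofReal] at h1
    have hpi : ((((2 * Real.pi) ^ 3 : ℝ) : ℂ))⁻¹ ≠ 0 :=
      inv_ne_zero (by exact_mod_cast (by positivity : (0 : ℝ) < (2 * Real.pi) ^ 3).ne')
    exact_mod_cast (mul_eq_zero.mp h1).resolve_left hpi
  norm_lt_top := hn

/-- Fatou's lemma for series: finite partial sums pass to the limit, and the full sum is their
supremum. -/
theorem gevreyNorm_le_of_tendsto {s r τ : ℝ} {l : Filter ℝ} [l.NeBot] {F : ℝ → Space → ℝ}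
    {g : Space → ℝ} {C : ℝ≥0} (hF : ∀ᶠ ν in l, gevreyNorm s r τ (F ν) ≤ C)
    (h : ∀ k, Tendsto (fun ν => fourierCoef (F ν) k) l (𝓝 (fourierCoef g k))) :
    gevreyNorm s r τ g ≤ C := by
  have key : ∀ f : Space → ℝ, gevreyNorm s r τ f ≤ C ↔ ∑' k : {k : Freq // k ≠ 0},
      ENNReal.ofReal (freqAbs k ^ (2 * r) * Real.exp (2 * τ * freqAbs k ^ (1 / s))
      * ‖fourierCoef f k‖ ^ 2) ≤ (C : ℝ≥0∞) ^ (2 : ℝ) := fun f => by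
    rw [gevreyNorm, one_div (2 : ℝ)]
    exact ENNReal.rpow_inv_le_iff two_pos
  simp only [key] at hF ⊢
  rw [ENNReal.tsum_eq_iSup_sum]
  refine iSup_le fun t => ?_
  have h1 : Tendsto (fun ν => ∑ k ∈ t, ENNReal.ofReal (freqAbs k ^ (2 * r) *
      Real.exp (2 * τ * freqAbs k ^ (1 / s)) * ‖fourierCoef (F ν) k‖ ^ 2)) l
      (𝓝 (∑ k ∈ t, ENNReal.ofReal (freqAbs k ^ (2 * r) *
      Real.exp (2 * τ * freqAbs k ^ (1 / s)) * ‖fourierCoef g k‖ ^ 2))) :=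
    tendsto_finsetSum _ fun k _ => (ENNReal.continuous_ofReal.tendsto _).comp
      (((h k).norm.pow 2).const_mul _)
  exact le_of_tendsto h1 (hF.mono fun ν hν => (ENNReal.sum_le_tsum t).trans hν)

theorem IsGevrey.exists_abs_le {s r τ : ℝ} {f : Space → ℝ} (hs : 0 < s) (hr : 0 ≤ r) (hτ : 0 < τ)
    (hf : IsGevrey s r τ f) : ∃ B : ℝ, 0 ≤ B ∧ ∀ x, |f x| ≤ B := by
  obtain ⟨C, hC⟩ := hf.exists_expDecay hs hr hτ
  have ha := (hC.absSummable hs hτ).summable.norm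
  refine ⟨∑' k, ‖fourierCoef f k‖, tsum_nonneg fun _ => norm_nonneg _, fun x => ?_⟩
  rw [← Real.norm_eq_abs, ← Complex.norm_real, ← (hC.hasSum x).tsum_eq]
  exact tsum_of_norm_bounded ha.hasSum fun k => by rw [norm_mul, norm_mode, mul_one]

/-- Along an ultrafilter of viscosities that tends to zero, uniformly bounded solutions converge
to a solution of the inviscid equation. -/
theorem exists_limit_solution {s r τ₀ τ T : ℝ} (hs : 0 < s) (hr : 0 ≤ r) (hτ₀ : 0 < τ₀)
    (hτ : 0 < τ) (hT : 0 ≤ T) {S θ₀ : Space → ℝ} (hS : IsGevrey s r τ₀ S)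
    {θ : ℝ → ℝ → Space → ℝ} (hθ : ∀ ν, 0 < ν → IsGevreySolution s r τ T ν S θ₀ (θ ν))
    {C : ℝ≥0} (hC : ∀ ν, 0 < ν → ∀ t ∈ Icc 0 T, gevreyNorm s r τ (θ ν t) ≤ C)
    {U : Ultrafilter ℝ} (hU : (U : Filter ℝ) ≤ 𝓝[>] 0) :
    ∃ ϑ : ℝ → Space → ℝ, IsGevreySolution s r τ T 0 S θ₀ ϑ ∧ ∀ t ∈ Icc 0 T, ∀ k,
      Tendsto (fun ν => fourierCoef (θ ν t) k) U (𝓝 (fourierCoef (ϑ t) k)) := by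
  obtain ⟨B, hB0, hB⟩ := hS.exists_abs_le hs hr hτ₀
  have hpos : ∀ᶠ ν in (U : Filter ℝ), 0 < ν := hU self_mem_nhdsWithin
  have hsol : ∀ ν, 0 < ν → DecaySolution s τ T C ν S (θ ν) := fun ν hν =>
    (hθ ν hν).decaySolution hs hr hτ (hC ν hν)
  -- An ultrafilter converges in every compact disc, so all times and frequencies are handled at
  -- once, with no extraction of subsequences.
  have hlim : ∀ t k, ∃ a : ℂ, t ∈ Icc 0 T →
      Tendsto (fun ν => fourierCoef (θ ν t) k) U (𝓝 a) := by
    intro t k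
    by_cases ht : t ∈ Icc 0 T
    · have hmem : ∀ᶠ ν in (U : Filter ℝ),
          fourierCoef (θ ν t) k ∈ Metric.closedBall (0 : ℂ) (C * expWeight s (-τ) k) := by
        filter_upwards [hpos] with ν hν
        rw [mem_closedBall_zero_iff]
        exact ((hsol ν hν).decay t ht).bound k
      obtain ⟨a, -, ha⟩ := (isCompact_closedBall (0 : ℂ) (C * expWeight s (-τ) k)).ultrafilter_le_nhds
        (U.map fun ν => fourierCoef (θ ν t) k) (le_principal_iff.mpr hmem)
      exact ⟨a, fun _ => ha⟩
    · exact ⟨0, fun h => absurd h ht⟩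
  choose a ha using hlim
  have hab : ∀ t ∈ Icc 0 T, ∀ k, ‖a t k‖ ≤ C * expWeight s (-τ) k := fun t ht k =>
    le_of_tendsto (ha t k ht).norm (hpos.mono fun ν hν => ((hsol ν hν).decay t ht).bound k)
  have ha0 : ∀ t ∈ Icc 0 T, a t 0 = 0 := fun t ht => by
    refine tendsto_nhds_unique (ha t 0 ht) (tendsto_const_nhds.congr' ?_)
    filter_upwards [hpos] with ν hν
    rw [fourierCoef_zero ((hθ ν hν).gevrey t ht).mean_zero]
  have htend : ∀ t ∈ Icc 0 T, ∀ x,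
      Tendsto (fun ν => (θ ν t x : ℂ)) U (𝓝 (∑' k, a t k * mode k x)) := fun t ht x => by
    have h1 : Tendsto (fun ν => ∑' k, fourierCoef (θ ν t) k * mode k x) U
        (𝓝 (∑' k, a t k * mode k x)) := by
      refine tendsto_tsum_of_dominated_convergence
        (bound := fun k => C * ((1 + freqAbs k) * expWeight s (-τ) k))
        ((summable_weight hs hτ).mul_left _) (fun k => (ha t k ht).mul_const _) ?_
      filter_upwards [hpos] with ν hν k
      rw [norm_mul, norm_mode, mul_one]
      have h1 := ((hsol ν hν).decay t ht).bound k
      have h2 := mul_nonneg (freqAbs_nonneg k) ((norm_nonneg _).trans h1)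
      linarith
    refine h1.congr' ?_
    filter_upwards [hpos] with ν hν
    exact (((hsol ν hν).decay t ht).hasSum x).tsum_eq
  let ϑ : ℝ → Space → ℝ := fun t x => (∑' k, a t k * mode k x).re
  have hreal : ∀ t ∈ Icc 0 T, ∀ x, ((ϑ t x : ℝ) : ℂ) = ∑' k, a t k * mode k x := fun t ht x => by
    refine Complex.ext (Complex.ofReal_re _) ?_
    rw [Complex.ofReal_im]
    have := (Complex.continuous_im.tendsto _).comp (htend t ht x)
    exact tendsto_nhds_unique tendsto_const_nhds (this.congr fun ν => Complex.ofReal_im _)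
  have hsum : ∀ t ∈ Icc 0 T, ∀ x, HasSum (fun k => a t k * mode k x) (ϑ t x) := fun t ht x => by
    rw [hreal t ht x]
    refine Summable.hasSum (Summable.of_norm ?_)
    simpa [norm_mode] using (absSummable_of_expBound hs hτ (hab t ht)).summable.norm
  have hcoef : ∀ t ∈ Icc 0 T, ∀ k, fourierCoef (ϑ t) k = a t k := fun t ht k =>
    fourierCoef_of_hasSum (absSummable_of_expBound hs hτ (hab t ht)).summable (hsum t ht) k
  have hconv : ∀ t ∈ Icc 0 T, ∀ k,
      Tendsto (fun ν => fourierCoef (θ ν t) k) U (𝓝 (fourierCoef (ϑ t) k)) := fun t ht k => by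
    rw [hcoef t ht k]; exact ha t k ht
  have hnorm : ∀ t ∈ Icc 0 T, gevreyNorm s r τ (ϑ t) ≤ C := fun t ht =>
    gevreyNorm_le_of_tendsto (hpos.mono fun ν hν => hC ν hν t ht) (hconv t ht)
  have hgev : ∀ t ∈ Icc 0 T, IsGevrey s r τ (ϑ t) := fun t ht =>
    isGevrey_of_hasSum hs hτ (hab t ht) (ha0 t ht) (hsum t ht)
      ((hnorm t ht).trans_lt ENNReal.coe_lt_top)
  refine ⟨ϑ, ⟨hgev, ⟨C, hnorm⟩, ?_, fun t₀ ht₀ x => ?_⟩, hconv⟩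
  · ext x
    have h1 := htend 0 ⟨le_rfl, hT⟩ x
    rw [← hreal 0 ⟨le_rfl, hT⟩ x] at h1
    have h2 : Tendsto (fun ν => (θ ν 0 x : ℂ)) U (𝓝 (θ₀ x : ℂ)) := by
      refine tendsto_const_nhds.congr' ?_
      filter_upwards [hpos] with ν hν
      rw [(hθ ν hν).initial]
    exact_mod_cast tendsto_nhds_unique h1 h2
  -- The constant `L` does not depend on `ν`, so the Taylor estimate for `θ ν` passes to the limit
  -- and yields the inviscid equation for `ϑ`.
  · obtain ⟨L, hL, hhol⟩ := DecaySolution.exists_holder (T := T) hs hτ C.coe_nonneg hB0 hB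
    refine hasDerivWithinAt_of_norm_taylor_le (L := L) fun t ht => ?_
    have hre : ∀ t ∈ Icc 0 T, Tendsto (fun ν => θ ν t x) U (𝓝 (ϑ t x)) := fun t ht =>
      ((Complex.continuous_re.tendsto _).comp (htend t ht x)).congr fun ν => Complex.ofReal_re _
    have hadv : Tendsto (fun ν => advection ν (θ ν t₀) x) U (𝓝 (advection 0 (ϑ t₀) x)) :=
      tendsto_advection hs hτ hU (hpos.mono fun ν hν => (hsol ν hν).decay t₀ ht₀)
        ((hgev t₀ ht₀).expDecay hs hr hτ (hnorm t₀ ht₀)) (hconv t₀ ht₀) x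
    have h1 : Tendsto (fun ν => |θ ν t x - θ ν t₀ x - (t - t₀) * (S x - advection ν (θ ν t₀) x)|) U
        (𝓝 |ϑ t x - ϑ t₀ x - (t - t₀) * (S x - advection 0 (ϑ t₀) x)|) :=
      (((hre t ht).sub (hre t₀ ht₀)).sub ((tendsto_const_nhds.sub hadv).const_mul _)).abs
    refine le_of_tendsto h1 (hpos.mono fun ν hν => ?_)
    refine abs_taylor_le_of_holder (F := fun t => θ ν t x)
      (G := fun t => S x - advection ν (θ ν t) x) hL
      (fun u hu => (hθ ν hν).equation u hu x) (fun u hu u' hu' => ?_) ht₀ ht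
    have := hhol ν (θ ν) hν.le (hsol ν hν) u hu u' hu' x
    rwa [sub_sub_sub_cancel_left, abs_sub_comm]

/-- Uniform bounds and uniqueness for the inviscid problem imply convergence. -/
theorem tendsto_gevreyNorm_of_bounded_of_unique {s r τ₀ τ T : ℝ} (hs : 0 < s) (hr : 0 ≤ r)
    (hτ₀ : 0 < τ₀) (hτ : 0 < τ) (hT : 0 ≤ T) {S θ₀ : Space → ℝ} (hS : IsGevrey s r τ₀ S)
    {θ : ℝ → ℝ → Space → ℝ} {ϑ : ℝ → Space → ℝ}
    (hθ : ∀ ν, 0 < ν → IsGevreySolution s r τ T ν S θ₀ (θ ν))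
    (hϑ : IsGevreySolution s r τ T 0 S θ₀ ϑ)
    {C : ℝ≥0} (hC : ∀ ν, 0 < ν → ∀ t ∈ Icc 0 T, gevreyNorm s r τ (θ ν t) ≤ C)
    (hunique : ∀ ϑ' : ℝ → Space → ℝ, IsGevreySolution s r τ T 0 S θ₀ ϑ' →
      ∀ t ∈ Icc 0 T, ϑ' t = ϑ t)
    {σ : ℝ} (hσ : σ < τ) {t : ℝ} (ht : t ∈ Icc 0 T) :
    Tendsto (fun ν => gevreyNorm s r σ (θ ν t - ϑ t)) (𝓝[>] 0) (𝓝 0) := by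
  have hpos : ∀ᶠ ν in 𝓝[>] (0 : ℝ), 0 < ν := self_mem_nhdsWithin
  obtain ⟨C', hC'⟩ := hϑ.bounded
  have hdecay : ∀ ν, 0 < ν → ∀ k,
      ‖fourierCoef (θ ν t) k‖ ≤ (C + C' : ℝ) * expWeight s (-τ) k := fun ν hν k =>
    (((hθ ν hν).gevrey t ht).expDecay hs hr hτ (hC ν hν t ht)).bound k |>.trans <|
      mul_le_mul_of_nonneg_right (by simp) (expWeight_pos _ _ _).le
  have hdecay0 : ∀ k, ‖fourierCoef (ϑ t) k‖ ≤ (C + C' : ℝ) * expWeight s (-τ) k := fun k =>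
    ((hϑ.gevrey t ht).expDecay hs hr hτ (hC' t ht)).bound k |>.trans <|
      mul_le_mul_of_nonneg_right (by simp) (expWeight_pos _ _ _).le
  refine tendsto_gevreyNorm_sub hs hσ (hpos.mono fun ν hν => ((hθ ν hν).gevrey t ht).continuous)
    (hϑ.gevrey t ht).continuous (hpos.mono hdecay) hdecay0 fun k => ?_
  -- Each ultrafilter has its own limit solution, and uniqueness forces all of them to be `ϑ`.
  rw [tendsto_iff_ultrafilter]
  intro U hU
  obtain ⟨ϑ', hϑ', hconv⟩ := exists_limit_solution hs hr hτ₀ hτ hT hS hθ hC hU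
  rw [← hunique ϑ' hϑ' t ht]
  exact hconv t ht k

/-! ### Convolutions and the bilinear term on the Fourier side. -/

section Convolution

variable {R : Type*} [NormedCommRing R] [CompleteSpace R] {a b : Freq → R}

/-- The change of variables `(k, l) ↦ (l, k - l)`. -/
def splitEquiv : Freq × Freq ≃ Freq × Freq where
  toFun p := (p.2, p.1 - p.2)
  invFun p := (p.1 + p.2, p.1)
  left_inv p := by simp
  right_inv p := by simp

theorem summable_convolution_prod (ha : Summable fun k => ‖a k‖) (hb : Summable fun k => ‖b k‖) :
    Summable fun p : Freq × Freq => a p.2 * b (p.1 - p.2) :=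
  splitEquiv.summable_iff.mpr (summable_mul_of_summable_norm ha hb)

theorem summable_convolution (ha : Summable fun k => ‖a k‖) (hb : Summable fun k => ‖b k‖)
    (k : Freq) : Summable fun l => a l * b (k - l) :=
  (summable_convolution_prod ha hb).prod_factor k

theorem hasSum_convolution (ha : Summable fun k => ‖a k‖) (hb : Summable fun k => ‖b k‖) :
    HasSum (fun k => ∑' l, a l * b (k - l)) ((∑' k, a k) * ∑' k, b k) := by
  rw [tsum_mul_tsum_of_summable_norm ha hb]
  have h := (splitEquiv.hasSum_iff).mpr (summable_mul_of_summable_norm ha hb).hasSum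
  exact h.prod_fiberwise fun k => (summable_convolution ha hb k).hasSum

end Convolution

/-- The bilinear term `∑_{l + m = k} (P(l) · i m) a(l) b(m)`. -/
noncomputable def bilin (P : Freq → Fin 3 → ℝ) (a b : Freq → ℂ) (k : Freq) : ℂ :=
  ∑ j, ∑' l, ((P l j : ℂ) * a l) * (Complex.I * ((k - l) j : ℂ) * b (k - l))

theorem hasSum_bilin_mul_mode {P : Freq → Fin 3 → ℝ} {a b : Freq → ℂ} {v p : Fin 3 → ℂ}
    {x : Space} (ha : ∀ j, HasSum (fun k => (P k j : ℂ) * a k * mode k x) (v j))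
    (hb : ∀ j, HasSum (fun k => Complex.I * (k j : ℂ) * b k * mode k x) (p j)) :
    HasSum (fun k => bilin P a b k * mode k x) (∑ j, v j * p j) := by
  have h1 : ∀ j, HasSum (fun k => (∑' l, ((P l j : ℂ) * a l) *
      (Complex.I * ((k - l) j : ℂ) * b (k - l))) * mode k x) (v j * p j) := fun j => by
    have h2 := hasSum_convolution (ha j).summable.norm (hb j).summable.norm
    rw [(ha j).tsum_eq, (hb j).tsum_eq] at h2
    refine h2.congr_fun fun k => ?_
    rw [← tsum_mul_right]
    refine tsum_congr fun l => ?_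
    have h3 : mode k x = mode l x * mode (k - l) x := by rw [← mode_add]; simp
    rw [h3]; simp only [Pi.sub_apply, Int.cast_sub]; ring
  refine (hasSum_sum fun j _ => h1 j).congr_fun fun k => ?_
  rw [bilin, Finset.sum_mul]

/-- Two trigonometric series which bound a bilinear term. -/
structure BilinBound (P : Freq → Fin 3 → ℝ) (p : Freq → ℝ) (a b : Freq → ℂ) (A B : Freq → ℝ) :
    Prop where
  symbol : ∀ k, ∑ j, |P k j| ≤ p k
  left : ∀ k, p k * ‖a k‖ ≤ A k
  right : ∀ k, freqAbs k * ‖b k‖ ≤ B k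
  summable_left : Summable A
  summable_right : Summable B

section

variable {P : Freq → Fin 3 → ℝ} {p : Freq → ℝ} {a b : Freq → ℂ} {A B : Freq → ℝ}

theorem BilinBound.left_nonneg (h : BilinBound P p a b A B) (k : Freq) : 0 ≤ A k :=
  (mul_nonneg ((Finset.sum_nonneg fun _ _ => abs_nonneg _).trans (h.symbol k))
    (norm_nonneg _)).trans (h.left k)

theorem BilinBound.right_nonneg (h : BilinBound P p a b A B) (k : Freq) : 0 ≤ B k :=
  (mul_nonneg (freqAbs_nonneg k) (norm_nonneg _)).trans (h.right k)

theorem BilinBound.norm_left_le (h : BilinBound P p a b A B) (j : Fin 3) (l : Freq) :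
    ‖(P l j : ℂ) * a l‖ ≤ A l := by
  rw [norm_mul, Complex.norm_real]
  exact (mul_le_mul_of_nonneg_right ((Finset.single_le_sum (f := fun j => |P l j|)
    (fun _ _ => abs_nonneg _) (Finset.mem_univ j)).trans (h.symbol l)) (norm_nonneg _)).trans
    (h.left l)

theorem BilinBound.norm_right_le (h : BilinBound P p a b A B) (j : Fin 3) (m : Freq) :
    ‖Complex.I * (m j : ℂ) * b m‖ ≤ B m := by
  rw [norm_mul]
  have := norm_I_mul_freq_le m j
  rw [one_mul] at this
  exact (mul_le_mul_of_nonneg_right this (norm_nonneg _)).trans (h.right m)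

theorem BilinBound.summable_norm_left (h : BilinBound P p a b A B) (j : Fin 3) :
    Summable fun l => ‖(P l j : ℂ) * a l‖ :=
  Summable.of_nonneg_of_le (fun _ => norm_nonneg _) (h.norm_left_le j) h.summable_left

theorem BilinBound.summable_norm_right (h : BilinBound P p a b A B) (j : Fin 3) :
    Summable fun m : Freq => ‖Complex.I * (m j : ℂ) * b m‖ :=
  Summable.of_nonneg_of_le (fun _ => norm_nonneg _) (h.norm_right_le j) h.summable_right

theorem BilinBound.summable_bilin_term (h : BilinBound P p a b A B) (j : Fin 3) (k : Freq) :
    Summable fun l => ((P l j : ℂ) * a l) * (Complex.I * ((k - l) j : ℂ) * b (k - l)) :=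
  summable_convolution (h.summable_norm_left j) (h.summable_norm_right j) k

theorem BilinBound.summable_convolution (h : BilinBound P p a b A B) (k : Freq) :
    Summable fun l => A l * B (k - l) :=
  MG.summable_convolution h.summable_left.norm h.summable_right.norm k

/-- The sum over `j` is moved inside the series, so that the symbol enters only through `∑ j, |P l
j|`. -/
theorem BilinBound.norm_bilin_le (h : BilinBound P p a b A B) (k : Freq) :
    ‖bilin P a b k‖ ≤ ∑' l, A l * B (k - l) := by
  have hs := h.summable_convolution k
  have h1 : bilin P a b k =
      ∑' l, ∑ j, ((P l j : ℂ) * a l) * (Complex.I * ((k - l) j : ℂ) * b (k - l)) := by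
    rw [bilin, Summable.tsum_finsetSum fun j _ => h.summable_bilin_term j k]
  rw [h1]
  refine tsum_of_norm_bounded hs.hasSum fun l => (norm_sum_le _ _).trans ?_
  have h2 : ∀ j ∈ Finset.univ, ‖((P l j : ℂ) * a l) * (Complex.I * ((k - l) j : ℂ) * b (k - l))‖ ≤
      |P l j| * ‖a l‖ * B (k - l) := fun j _ => by
    rw [norm_mul, norm_mul (P l j : ℂ), Complex.norm_real]
    exact mul_le_mul_of_nonneg_left (h.norm_right_le j (k - l)) (by positivity)
  refine (Finset.sum_le_sum h2).trans ?_
  rw [← Finset.sum_mul, ← Finset.sum_mul]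
  exact mul_le_mul_of_nonneg_right
    ((mul_le_mul_of_nonneg_right (h.symbol l) (norm_nonneg _)).trans (h.left l))
    (h.right_nonneg _)

end

/-- A weight that grows at most multiplicatively. -/
theorem mul_tsum_convolution_le {w A B A' B' : Freq → ℝ} (hA : ∀ k, 0 ≤ A k) (hB : ∀ k, 0 ≤ B k)
    (hw : ∀ k l, w k ≤ w l * w (k - l)) (hA' : ∀ k, w k * A k = A' k) (hB' : ∀ k, w k * B k = B' k)
    (hs : Summable A) (hsB : Summable B) (hsA' : Summable A') (hsB' : Summable B') (k : Freq) :
    w k * ∑' l, A l * B (k - l) ≤ ∑' l, A' l * B' (k - l) := by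
  rw [← tsum_mul_left]
  refine ((summable_convolution hs.norm hsB.norm k).mul_left _).tsum_le_tsum (fun l => ?_)
    (summable_convolution hsA'.norm hsB'.norm k)
  rw [← hA', ← hB']
  calc w k * (A l * B (k - l)) ≤ w l * w (k - l) * (A l * B (k - l)) :=
        mul_le_mul_of_nonneg_right (hw k l) (mul_nonneg (hA _) (hB _))
    _ = _ := by ring

/-- The Leibniz rule in Fourier variables, from `|k| ≤ |l| + |k - l|`. -/
theorem freqAbs_mul_tsum_convolution_le {A B : Freq → ℝ} (hA : ∀ k, 0 ≤ A k) (hB : ∀ k, 0 ≤ B k)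
    (hs : Summable A) (hsB : Summable B) (hsA' : Summable fun k => freqAbs k * A k)
    (hsB' : Summable fun k => freqAbs k * B k) (k : Freq) :
    freqAbs k * ∑' l, A l * B (k - l) ≤
      ∑' l, (freqAbs l * A l) * B (k - l) + ∑' l, A l * (freqAbs (k - l) * B (k - l)) := by
  have h1 := summable_convolution hsA'.norm hsB.norm k
  have h2 := summable_convolution hs.norm hsB'.norm k
  rw [← tsum_mul_left, ← h1.tsum_add h2]
  refine ((summable_convolution hs.norm hsB.norm k).mul_left _).tsum_le_tsum (fun l => ?_)
    (h1.add h2)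
  calc freqAbs k * (A l * B (k - l)) ≤ (freqAbs l + freqAbs (k - l)) * (A l * B (k - l)) :=
        mul_le_mul_of_nonneg_right (freqAbs_le_add_sub k l) (mul_nonneg (hA _) (hB _))
    _ = _ := by ring

/-! ### The analytic case: weights with shrinking radius. -/

theorem expWeight_one (τ : ℝ) (k : Freq) : expWeight 1 τ k = Real.exp (τ * freqAbs k) := by
  rw [expWeight, one_div_one, Real.rpow_one]

theorem expWeight_one_le_mul {τ : ℝ} (hτ : 0 ≤ τ) (k l : Freq) :
    expWeight 1 τ k ≤ expWeight 1 τ l * expWeight 1 τ (k - l) := by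
  simp only [expWeight_one]
  rw [← Real.exp_add, ← mul_add]
  exact Real.exp_le_exp.mpr (mul_le_mul_of_nonneg_left (freqAbs_le_add_sub k l) hτ)

theorem abs_exp_sub_exp_le {x y z : ℝ} (hx : x ≤ z) (hy : y ≤ z) :
    |Real.exp x - Real.exp y| ≤ Real.exp z * |x - y| := by
  have h := (convex_Iic z).norm_image_sub_le_of_norm_deriv_le (f := Real.exp) (C := Real.exp z)
    (fun u _ => Real.differentiableAt_exp)
    (fun u hu => by rw [Real.deriv_exp, Real.norm_of_nonneg (Real.exp_pos u).le]
                    exact Real.exp_le_exp.mpr hu) hy hx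
  simpa using h

/-- A differential inequality for weighted `ℓ¹` norms whose exponential weight shrinks in time. -/
theorem tsum_exp_mul_norm_le {T τ κ β B₀ : ℝ} (hκ : 0 ≤ κ) {n : Freq → ℝ}
    (hn : ∀ k, 0 ≤ n k) {c c' : ℝ → Freq → ℂ} {G : Freq → ℝ}
    (hc : ∀ t ∈ Icc 0 T, ∀ k, HasDerivWithinAt (fun t => c t k) (c' t k) (Icc 0 T) t)
    (hG : ∀ t ∈ Icc 0 T, ∀ k, ‖c t k‖ ≤ G k) (hG' : ∀ t ∈ Icc 0 T, ∀ k, ‖c' t k‖ ≤ G k)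
    (hsum : Summable fun k => (1 + freqAbs k) * (n k * Real.exp (τ * freqAbs k) * G k))
    (h0 : ∑' k, n k * Real.exp (τ * freqAbs k) * ‖c 0 k‖ ≤ B₀)
    (hstep : ∀ t ∈ Ico 0 T,
      ∑' k, n k * Real.exp ((τ - κ * t) * freqAbs k) * ‖c t k‖ = B₀ + β * t →
      ∑' k, n k * Real.exp ((τ - κ * t) * freqAbs k) * (‖c' t k‖ - κ * freqAbs k * ‖c t k‖) < β)
    {t : ℝ} (ht : t ∈ Icc 0 T) :
    ∑' k, n k * Real.exp ((τ - κ * t) * freqAbs k) * ‖c t k‖ ≤ B₀ + β * t := by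
  have hexp : ∀ t ∈ Icc 0 T, ∀ k, (τ - κ * t) * freqAbs k ≤ τ * freqAbs k := fun t ht k =>
    mul_le_mul_of_nonneg_right (sub_le_self _ (mul_nonneg hκ ht.1)) (freqAbs_nonneg k)
  have hbd : ∀ t ∈ Icc 0 T, ∀ k, ‖n k * Real.exp ((τ - κ * t) * freqAbs k) * ‖c t k‖‖ ≤
      (1 + freqAbs k) * (n k * Real.exp (τ * freqAbs k) * G k) := fun t ht k => by
    have hk := hn k
    have hG0 := (norm_nonneg _).trans (hG t ht k)
    rw [Real.norm_of_nonneg (by positivity)]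
    calc n k * Real.exp ((τ - κ * t) * freqAbs k) * ‖c t k‖ ≤
          n k * Real.exp (τ * freqAbs k) * G k := by
            gcongr n k * ?_ * ?_
            · exact Real.exp_le_exp.mpr (hexp t ht k)
            · exact hG t ht k
      _ ≤ _ := le_mul_of_one_le_left (by positivity) (by linarith [freqAbs_nonneg k])
  have hZs : ∀ t ∈ Icc 0 T,
      Summable fun k => n k * Real.exp ((τ - κ * t) * freqAbs k) * ‖c t k‖ := fun t ht =>
    Summable.of_norm_bounded hsum (hbd t ht)
  -- The norm `‖c t k‖` need not be differentiable at its zeros, so `f'` is only an upper bound for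
  -- the right slopes of `f`. The strict inequality with `β` is required only at times when the sum
  -- touches the barrier.
  refine image_le_of_liminf_slope_right_lt_deriv_boundary
    (f := fun t => ∑' k, n k * Real.exp ((τ - κ * t) * freqAbs k) * ‖c t k‖)
    (f' := fun t => ∑' k, n k * Real.exp ((τ - κ * t) * freqAbs k) *
      (‖c' t k‖ - κ * freqAbs k * ‖c t k‖))
    (B := fun t => B₀ + β * t) (B' := fun _ => β) ?_ ?_ ?_ ?_ hstep ht
  · refine continuousOn_tsum (fun k => ?_) hsum fun k t ht => hbd t ht k
    refine ContinuousOn.mul (by fun_prop) (ContinuousOn.norm fun t ht => ?_)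
    exact (hc t ht k).continuousWithinAt
  · intro t ht r hr
    have htI : t ∈ Icc 0 T := Ico_subset_Icc_self ht
    refine Eventually.frequently ?_
    have hmem : Icc 0 T ∈ 𝓝[>] t := Icc_mem_nhdsGT_of_mem ht
    -- A termwise majorant of the difference quotient, obtained from `‖c z k‖ - ‖c t k‖ ≤ ‖c z k - c
    -- t k‖`; unlike the quotient itself it has a limit as `z → t⁺`.
    let q : ℝ → Freq → ℝ := fun z k =>
      n k * (Real.exp ((τ - κ * z) * freqAbs k) * ‖slope (fun t => c t k) t z‖ +
        ‖c t k‖ * slope (fun z => Real.exp ((τ - κ * z) * freqAbs k)) t z)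
    have hq : ∀ k, Tendsto (fun z => q z k) (𝓝[>] t)
        (𝓝 (n k * Real.exp ((τ - κ * t) * freqAbs k) *
          (‖c' t k‖ - κ * freqAbs k * ‖c t k‖))) := fun k => by
      have e1 : Tendsto (fun z => Real.exp ((τ - κ * z) * freqAbs k)) (𝓝[>] t)
          (𝓝 (Real.exp ((τ - κ * t) * freqAbs k))) :=
        (Continuous.tendsto (by fun_prop) t).mono_left nhdsWithin_le_nhds
      have e2 : Tendsto (slope (fun t => c t k) t) (𝓝[>] t) (𝓝 (c' t k)) :=
        (hasDerivWithinAt_iff_tendsto_slope' (by simp)).mp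
          ((hc t htI k).mono_of_mem_nhdsWithin hmem)
      have e3 : HasDerivAt (fun z => Real.exp ((τ - κ * z) * freqAbs k))
          (Real.exp ((τ - κ * t) * freqAbs k) * (-(κ * 1) * freqAbs k)) t :=
        ((((hasDerivAt_id t).const_mul κ).const_sub τ).mul_const _).exp
      have e4 : Tendsto (slope (fun z => Real.exp ((τ - κ * z) * freqAbs k)) t) (𝓝[>] t)
          (𝓝 (Real.exp ((τ - κ * t) * freqAbs k) * (-(κ * 1) * freqAbs k))) :=
        (hasDerivWithinAt_iff_tendsto_slope' (by simp)).mp e3.hasDerivWithinAt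
      have := ((e1.mul e2.norm).add (e4.const_mul ‖c t k‖)).const_mul (n k)
      convert this using 2
      ring
    have hqb : ∀ᶠ z in 𝓝[>] t, ∀ k, ‖q z k‖ ≤
        (1 + κ) * ((1 + freqAbs k) * (n k * Real.exp (τ * freqAbs k) * G k)) := by
      filter_upwards [hmem, self_mem_nhdsWithin] with z hz hzt k
      have hzt' : 0 < z - t := sub_pos.mpr hzt
      have hk := hn k
      have hf := freqAbs_nonneg k
      have hG0 := (norm_nonneg _).trans (hG t htI k)
      have e1 : ‖slope (fun t => c t k) t z‖ ≤ G k := by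
        rw [slope_def_module, norm_smul, norm_inv, Real.norm_of_nonneg hzt'.le,
          inv_mul_le_iff₀ hzt']
        have := (convex_Icc 0 T).norm_image_sub_le_of_norm_hasDerivWithin_le
          (fun u hu => hc u hu k) (fun u hu => hG' u hu k) htI hz
        rw [Real.norm_of_nonneg hzt'.le] at this
        linarith
      have e2 : |slope (fun z => Real.exp ((τ - κ * z) * freqAbs k)) t z| ≤
          κ * freqAbs k * Real.exp (τ * freqAbs k) := by
        rw [slope_def_field, abs_div, abs_of_pos hzt', div_le_iff₀ hzt']
        refine (abs_exp_sub_exp_le (hexp z hz k) (hexp t htI k)).trans (le_of_eq ?_)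
        have : (τ - κ * z) * freqAbs k - (τ - κ * t) * freqAbs k =
          -(κ * freqAbs k * (z - t)) := by ring
        rw [this, abs_neg, abs_of_nonneg (by positivity)]
        ring
      rw [Real.norm_eq_abs, abs_mul, abs_of_nonneg hk]
      calc n k * |Real.exp ((τ - κ * z) * freqAbs k) * ‖slope (fun t => c t k) t z‖ +
            ‖c t k‖ * slope (fun z => Real.exp ((τ - κ * z) * freqAbs k)) t z|
          ≤ n k * (Real.exp (τ * freqAbs k) * G k +
              G k * (κ * freqAbs k * Real.exp (τ * freqAbs k))) := by
            refine mul_le_mul_of_nonneg_left ((abs_add_le _ _).trans (add_le_add ?_ ?_)) hk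
            · rw [abs_of_nonneg (by positivity)]
              exact mul_le_mul (Real.exp_le_exp.mpr (hexp z hz k)) e1 (norm_nonneg _)
                (Real.exp_pos _).le
            · rw [abs_mul, abs_of_nonneg (norm_nonneg _)]
              exact mul_le_mul (hG t htI k) e2 (abs_nonneg _) hG0
        _ = (1 + κ * freqAbs k) * (n k * Real.exp (τ * freqAbs k) * G k) := by ring
        _ ≤ ((1 + κ) * (1 + freqAbs k)) * (n k * Real.exp (τ * freqAbs k) * G k) := by
            gcongr; nlinarith
        _ = _ := by ring
    have hlim := tendsto_tsum_of_dominated_convergence (hsum.mul_left (1 + κ)) hq hqb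
    filter_upwards [hlim.eventually (gt_mem_nhds hr), hqb, hmem, self_mem_nhdsWithin]
      with z hzr hzb hz hzt
    refine lt_of_le_of_lt ?_ hzr
    have hzt' : 0 < z - t := sub_pos.mpr hzt
    rw [slope_def_field, ← (hZs z hz).tsum_sub (hZs t htI), ← tsum_div_const]
    refine (((hZs z hz).sub (hZs t htI)).div_const _).tsum_le_tsum (fun k => ?_)
      (Summable.of_norm_bounded (hsum.mul_left (1 + κ)) hzb)
    simp only [q]
    rw [slope_def_module, norm_smul, norm_inv, Real.norm_of_nonneg hzt'.le, slope_def_field,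
      div_le_iff₀ hzt']
    have e1 : ‖c z k‖ ≤ ‖c z k - c t k‖ + ‖c t k‖ := by simpa using norm_add_le (c z k - c t k) (c t k)
    have e2 : n k * (Real.exp ((τ - κ * z) * freqAbs k) * ((z - t)⁻¹ * ‖c z k - c t k‖) +
        ‖c t k‖ * ((Real.exp ((τ - κ * z) * freqAbs k) - Real.exp ((τ - κ * t) * freqAbs k)) /
          (z - t))) * (z - t) = n k * (Real.exp ((τ - κ * z) * freqAbs k) * ‖c z k - c t k‖ +
        ‖c t k‖ * (Real.exp ((τ - κ * z) * freqAbs k) - Real.exp ((τ - κ * t) * freqAbs k))) := by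
      field_simp
    rw [e2]
    have e3 := mul_le_mul_of_nonneg_left e1
      (mul_nonneg (hn k) (Real.exp_pos ((τ - κ * z) * freqAbs k)).le)
    linarith
  · simpa using h0
  · intro x
    simpa using ((hasDerivAt_id x).const_mul β).const_add B₀

theorem fourierCoef_const_mul (c : ℝ) (f : Space → ℝ) (k : Freq) :
    fourierCoef (fun x => c * f x) k = c * fourierCoef f k := by
  simp only [fourierCoef, Complex.ofReal_mul, mul_assoc, integral_const_mul]
  ring

/-! ### Weighted `ℓ¹` estimates for the bilinear term. -/

section

variable {P : Freq → Fin 3 → ℝ} {p : Freq → ℝ} {a b : Freq → ℂ} {τ : ℝ}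

theorem one_le_expWeight_one (hτ : 0 ≤ τ) (k : Freq) : 1 ≤ expWeight 1 τ k := by
  rw [expWeight_one]; exact Real.one_le_exp (mul_nonneg hτ (freqAbs_nonneg k))

theorem summable_of_summable_weight_mul (hτ : 0 ≤ τ) {u : Freq → ℝ} (hu : ∀ k, 0 ≤ u k)
    (h : Summable fun k => expWeight 1 τ k * u k) : Summable u :=
  Summable.of_nonneg_of_le hu (fun k => le_mul_of_one_le_left (hu k) (one_le_expWeight_one hτ k)) h

theorem bilinBound_of_summable (hτ : 0 ≤ τ) (hp : ∀ k, ∑ j, |P k j| ≤ p k)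
    (hA : Summable fun k => expWeight 1 τ k * (p k * ‖a k‖))
    (hB : Summable fun k => expWeight 1 τ k * (freqAbs k * ‖b k‖)) :
    BilinBound P p a b (fun k => p k * ‖a k‖) (fun k => freqAbs k * ‖b k‖) where
  symbol := hp
  left _ := le_rfl
  right _ := le_rfl
  summable_left := summable_of_summable_weight_mul hτ (fun k => mul_nonneg
    ((Finset.sum_nonneg fun _ _ => abs_nonneg _).trans (hp k)) (norm_nonneg _)) hA
  summable_right := summable_of_summable_weight_mul hτ (fun k => mul_nonneg (freqAbs_nonneg k)
    (norm_nonneg _)) hB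

theorem weight_mul_norm_bilin_le (hτ : 0 ≤ τ) (hp : ∀ k, ∑ j, |P k j| ≤ p k)
    (hA : Summable fun k => expWeight 1 τ k * (p k * ‖a k‖))
    (hB : Summable fun k => expWeight 1 τ k * (freqAbs k * ‖b k‖)) (k : Freq) :
    expWeight 1 τ k * ‖bilin P a b k‖ ≤ ∑' l, (expWeight 1 τ l * (p l * ‖a l‖)) *
      (expWeight 1 τ (k - l) * (freqAbs (k - l) * ‖b (k - l)‖)) := by
  have h := bilinBound_of_summable hτ hp hA hB
  refine (mul_le_mul_of_nonneg_left (h.norm_bilin_le k) (expWeight_pos _ _ _).le).trans ?_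
  exact mul_tsum_convolution_le h.left_nonneg h.right_nonneg (expWeight_one_le_mul hτ)
    (A' := fun k => expWeight 1 τ k * (p k * ‖a k‖))
    (B' := fun k => expWeight 1 τ k * (freqAbs k * ‖b k‖))
    (fun _ => rfl) (fun _ => rfl) h.summable_left h.summable_right hA hB k

/-- The weighted `ℓ¹` bound of the bilinear term. -/
theorem tsum_weight_mul_norm_bilin_le (hτ : 0 ≤ τ) (hp : ∀ k, ∑ j, |P k j| ≤ p k)
    (hA : Summable fun k => expWeight 1 τ k * (p k * ‖a k‖))
    (hB : Summable fun k => expWeight 1 τ k * (freqAbs k * ‖b k‖)) :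
    Summable (fun k => expWeight 1 τ k * ‖bilin P a b k‖) ∧
      ∑' k, expWeight 1 τ k * ‖bilin P a b k‖ ≤
        (∑' k, expWeight 1 τ k * (p k * ‖a k‖)) *
          ∑' k, expWeight 1 τ k * (freqAbs k * ‖b k‖) := by
  have h1 := hasSum_convolution hA.norm hB.norm
  have h2 := weight_mul_norm_bilin_le hτ hp hA hB
  have h3 : Summable fun k => expWeight 1 τ k * ‖bilin P a b k‖ :=
    Summable.of_nonneg_of_le (fun k => mul_nonneg (expWeight_pos _ _ _).le (norm_nonneg _)) h2
      h1.summable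
  refine ⟨h3, ?_⟩
  rw [← h1.tsum_eq]
  exact h3.tsum_le_tsum h2 h1.summable

/-- The weighted `ℓ¹` bound of the derivative of the bilinear term. -/
theorem tsum_freqAbs_mul_weight_mul_norm_bilin_le (hτ : 0 ≤ τ) (hp : ∀ k, ∑ j, |P k j| ≤ p k)
    (hA : Summable fun k => expWeight 1 τ k * (p k * ‖a k‖))
    (hB : Summable fun k => expWeight 1 τ k * (freqAbs k * ‖b k‖))
    (hA' : Summable fun k => freqAbs k * (expWeight 1 τ k * (p k * ‖a k‖)))
    (hB' : Summable fun k => freqAbs k * (expWeight 1 τ k * (freqAbs k * ‖b k‖))) :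
    Summable (fun k => freqAbs k * (expWeight 1 τ k * ‖bilin P a b k‖)) ∧
      ∑' k, freqAbs k * (expWeight 1 τ k * ‖bilin P a b k‖) ≤
        (∑' k, freqAbs k * (expWeight 1 τ k * (p k * ‖a k‖))) *
          (∑' k, expWeight 1 τ k * (freqAbs k * ‖b k‖)) +
        (∑' k, expWeight 1 τ k * (p k * ‖a k‖)) *
          ∑' k, freqAbs k * (expWeight 1 τ k * (freqAbs k * ‖b k‖)) := by
  have h := bilinBound_of_summable hτ hp hA hB
  have h1 := (hasSum_convolution hA'.norm hB.norm).add (hasSum_convolution hA.norm hB'.norm)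
  have h2 := fun k => (mul_le_mul_of_nonneg_left (weight_mul_norm_bilin_le hτ hp hA hB k)
    (freqAbs_nonneg k)).trans (freqAbs_mul_tsum_convolution_le
      (fun k => mul_nonneg (expWeight_pos 1 τ k).le (h.left_nonneg k))
      (fun k => mul_nonneg (expWeight_pos 1 τ k).le (h.right_nonneg k)) hA hB hA' hB' k)
  have h3 : Summable fun k => freqAbs k * (expWeight 1 τ k * ‖bilin P a b k‖) :=
    Summable.of_nonneg_of_le (fun k => mul_nonneg (freqAbs_nonneg k)
      (mul_nonneg (expWeight_pos _ _ _).le (norm_nonneg _))) h2 h1.summable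
  refine ⟨h3, ?_⟩
  rw [← h1.tsum_eq]
  exact h3.tsum_le_tsum h2 h1.summable

end

theorem summable_pow_mul_weight_mul_norm {τ ρ C : ℝ} (h : τ < ρ) {a : Freq → ℂ}
    (ha : ∀ k, ‖a k‖ ≤ C * expWeight 1 (-ρ) k) (p : ℕ) :
    Summable fun k => (1 + freqAbs k) ^ p * (expWeight 1 τ k * ‖a k‖) := by
  refine Summable.of_nonneg_of_le (fun k => ?_) (fun k => ?_)
    ((summable_pow_mul_expWeight one_pos (sub_neg.mpr h) p).mul_left C)
  · have := freqAbs_nonneg k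
    have := expWeight_pos 1 τ k
    positivity
  · have := freqAbs_nonneg k
    have h1 := expWeight_pos 1 τ k
    calc _ ≤ (1 + freqAbs k) ^ p * (expWeight 1 τ k * (C * expWeight 1 (-ρ) k)) := by
          gcongr; exact ha k
      _ = C * ((1 + freqAbs k) ^ p * (expWeight 1 τ k * expWeight 1 (-ρ) k)) := by ring
      _ = _ := by rw [expWeight_mul, sub_eq_add_neg]

theorem summable_weight_mul_of_le {τ ρ C D : ℝ} (h : τ < ρ) {a : Freq → ℂ}
    (ha : ∀ k, ‖a k‖ ≤ C * expWeight 1 (-ρ) k) (p : ℕ) {q : Freq → ℝ} (hq0 : ∀ k, 0 ≤ q k)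
    (hq : ∀ k, q k ≤ D * (1 + freqAbs k) ^ p) :
    Summable fun k => q k * (expWeight 1 τ k * ‖a k‖) := by
  refine Summable.of_nonneg_of_le (fun k => ?_) (fun k => ?_)
    ((summable_pow_mul_weight_mul_norm h ha p).mul_left D)
  · exact mul_nonneg (hq0 k) (mul_nonneg (expWeight_pos 1 τ k).le (norm_nonneg _))
  · exact (mul_le_mul_of_nonneg_right (hq k)
      (mul_nonneg (expWeight_pos 1 τ k).le (norm_nonneg (a k)))).trans_eq (mul_assoc _ _ _)

/-- One coefficient is at most the whole weighted sum at radius `ρ'`, and the loss from `ρ` to `ρ'`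
pays for the factor `|k|` on each argument. This serves to dominate the time derivatives of the
coefficients. -/
theorem norm_bilin_le_expWeight {P : Freq → Fin 3 → ℝ} {a b : Freq → ℂ} {ρ ρ' C D : ℝ}
    (hρ' : 0 ≤ ρ') (hρ : ρ' < ρ) (hP : ∀ k, ∑ j, |P k j| ≤ D * freqAbs k)
    (ha : ∀ k, ‖a k‖ ≤ C * expWeight 1 (-ρ) k) (hb : ∀ k, ‖b k‖ ≤ C * expWeight 1 (-ρ) k)
    (hD : 0 ≤ D) (hC : 0 ≤ C) (k : Freq) :
    ‖bilin P a b k‖ ≤ (D * (C * weightSum 1 (ρ - ρ')) * (C * weightSum 1 (ρ - ρ'))) *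
      expWeight 1 (-ρ') k := by
  have hq0 : ∀ k, 0 ≤ D * freqAbs k := fun k => mul_nonneg hD (freqAbs_nonneg k)
  have hA : Summable fun k => expWeight 1 ρ' k * ((D * freqAbs k) * ‖a k‖) :=
    (summable_weight_mul_of_le hρ ha 1 (D := D) hq0 fun k => by
      rw [pow_one]; exact mul_le_mul_of_nonneg_left (by linarith) hD).congr fun k => by ring
  have hB : Summable fun k => expWeight 1 ρ' k * (freqAbs k * ‖b k‖) :=
    (summable_weight_mul_of_le hρ hb 1 (D := 1) freqAbs_nonneg fun k => by
      rw [pow_one]; linarith).congr fun k => by ring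
  have hw : ∀ {a : Freq → ℂ}, (∀ k, ‖a k‖ ≤ C * expWeight 1 (-ρ) k) →
      (Summable fun k => expWeight 1 ρ' k * (freqAbs k * ‖a k‖)) →
      ∑' k, expWeight 1 ρ' k * (freqAbs k * ‖a k‖) ≤ C * weightSum 1 (ρ - ρ') := by
    intro a ha hs
    rw [weightSum, ← tsum_mul_left]
    refine hs.tsum_le_tsum (fun k => ?_)
      ((summable_weight one_pos (sub_pos.mpr hρ)).mul_left C)
    have h0 := freqAbs_nonneg k
    have h1 := expWeight_pos 1 ρ' k
    have h2 := expWeight_pos 1 (-(ρ - ρ')) k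
    have h3 : expWeight 1 (-(ρ - ρ')) k = expWeight 1 ρ' k * expWeight 1 (-ρ) k := by
      rw [expWeight_mul]; congr 1; ring
    calc expWeight 1 ρ' k * (freqAbs k * ‖a k‖) ≤
          expWeight 1 ρ' k * (freqAbs k * (C * expWeight 1 (-ρ) k)) := by gcongr; exact ha k
      _ = C * (freqAbs k * expWeight 1 (-(ρ - ρ')) k) := by rw [h3]; ring
      _ ≤ _ := by gcongr; linarith
  have h1 := tsum_weight_mul_norm_bilin_le hρ' hP hA hB
  have h2 : expWeight 1 ρ' k * ‖bilin P a b k‖ ≤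
      ∑' k, expWeight 1 ρ' k * ‖bilin P a b k‖ :=
    h1.1.le_tsum k fun j _ => mul_nonneg (expWeight_pos _ _ _).le (norm_nonneg _)
  have h3 : ∑' k, expWeight 1 ρ' k * ((D * freqAbs k) * ‖a k‖) ≤
      D * (C * weightSum 1 (ρ - ρ')) := by
    have e : ∀ k, expWeight 1 ρ' k * ((D * freqAbs k) * ‖a k‖) =
        D * (expWeight 1 ρ' k * (freqAbs k * ‖a k‖)) := fun k => by ring
    simp only [e]
    rw [tsum_mul_left]
    refine mul_le_mul_of_nonneg_left (hw ha ?_) hD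
    exact (summable_weight_mul_of_le hρ ha 1 (D := 1) freqAbs_nonneg fun k => by
      rw [pow_one]; linarith).congr fun k => by ring
  have h4 := h2.trans (h1.2.trans (mul_le_mul h3 (hw hb hB)
    (tsum_nonneg fun k => mul_nonneg (expWeight_pos _ _ _).le
      (mul_nonneg (freqAbs_nonneg k) (norm_nonneg _)))
    (mul_nonneg hD (mul_nonneg hC (weightSum_nonneg _ _)))))
  have h5 : ‖bilin P a b k‖ = expWeight 1 ρ' k * ‖bilin P a b k‖ * expWeight 1 (-ρ') k := by
    rw [mul_right_comm, expWeight_mul]; simp [expWeight]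
  rw [h5]
  exact mul_le_mul_of_nonneg_right h4 (expWeight_pos _ _ _).le

/-- Telescoping in the three arguments, one replaced at a time; the five bounds serve only to make
the series converge. -/
theorem bilin_sub_bilin {P P' : Freq → Fin 3 → ℝ} {a a' b b' : Freq → ℂ}
    {p p₁ p₂ p₃ p₄ A A₁ A₂ A₃ A₄ B B₁ B₂ B₃ B₄ : Freq → ℝ}
    (h : BilinBound P p a b A B) (h₁ : BilinBound P' p₁ a' b' A₁ B₁)
    (h₂ : BilinBound P p₂ (a - a') b A₂ B₂) (h₃ : BilinBound (P - P') p₃ a' b A₃ B₃)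
    (h₄ : BilinBound P' p₄ a' (b - b') A₄ B₄) (k : Freq) :
    bilin P a b k - bilin P' a' b' k =
      bilin P (a - a') b k + bilin (P - P') a' b k + bilin P' a' (b - b') k := by
  simp only [bilin]
  rw [← Finset.sum_sub_distrib, ← Finset.sum_add_distrib, ← Finset.sum_add_distrib]
  refine Finset.sum_congr rfl fun j _ => ?_
  rw [← (h.summable_bilin_term j k).tsum_sub (h₁.summable_bilin_term j k),
    ← (h₂.summable_bilin_term j k).tsum_add (h₃.summable_bilin_term j k),
    ← ((h₂.summable_bilin_term j k).add (h₃.summable_bilin_term j k)).tsum_add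
      (h₄.summable_bilin_term j k)]
  refine tsum_congr fun l => ?_
  simp only [Pi.sub_apply, Complex.ofReal_sub]
  ring

theorem bilinBound_fourierCoef {ν s τ C : ℝ} (hν : 0 ≤ ν) (hs : 0 < s) (hτ : 0 < τ)
    {f : Space → ℝ} (hf : ExpDecay s τ C f) :
    BilinBound (symbolM ν) (fun k => 6 * freqAbs k) (fourierCoef f) (fourierCoef f)
      (fun k => 6 * (freqAbs k * ‖fourierCoef f k‖)) (fun k => freqAbs k * ‖fourierCoef f k‖) where
  symbol := sum_abs_symbolM_le hν
  left _ := (mul_assoc _ _ _).le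
  right _ := le_rfl
  summable_left := (hf.absSummable hs hτ).summable_freqAbs.mul_left 6
  summable_right := (hf.absSummable hs hτ).summable_freqAbs

theorem hasSum_advection {ν s τ C : ℝ} (hν : 0 ≤ ν) (hs : 0 < s) (hτ : 0 < τ)
    {f : Space → ℝ} (hf : ExpDecay s τ C f) (x : Space) :
    HasSum (fun k => bilin (symbolM ν) (fourierCoef f) (fourierCoef f) k * mode k x)
      ((advection ν f x : ℝ) : ℂ) := by
  have ha := hf.absSummable hs hτ
  have := hasSum_bilin_mul_mode (fun j => hasSum_velocity hν ha j x)
    (fun j => hasSum_fderiv ha hf.hasSum j x)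
  rw [advection]
  push_cast
  exact this

theorem summable_bilin {ν s τ C : ℝ} (hν : 0 ≤ ν) (hs : 0 < s) (hτ : 0 < τ)
    {f : Space → ℝ} (hf : ExpDecay s τ C f) :
    Summable (bilin (symbolM ν) (fourierCoef f) (fourierCoef f)) := by
  have h := bilinBound_fourierCoef hν hs hτ hf
  exact Summable.of_norm_bounded
    (hasSum_convolution h.summable_left.norm h.summable_right.norm).summable h.norm_bilin_le

/-- The equation is given pointwise in `x`. Its Taylor estimate is uniform in `x`, hence carries
over to Fourier coefficients, which are bounded by the supremum. -/
theorem DecaySolution.hasDerivWithinAt_fourierCoef {s τ T C ν τS CS : ℝ} {S : Space → ℝ}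
    {θ : ℝ → Space → ℝ} (h : DecaySolution s τ T C ν S θ) (hs : 0 < s) (hτ : 0 < τ) (hC : 0 ≤ C)
    (hν : 0 ≤ ν) (hτS : 0 < τS) (hS : ExpDecay s τS CS S) {B : ℝ} (hB0 : 0 ≤ B)
    (hB : ∀ x, |S x| ≤ B) {t : ℝ} (ht : t ∈ Icc 0 T) (k : Freq) :
    HasDerivWithinAt (fun t => fourierCoef (θ t) k) (fourierCoef S k -
      bilin (symbolM ν) (fourierCoef (θ t)) (fourierCoef (θ t)) k) (Icc 0 T) t := by
  have hSs := (hS.absSummable hs hτS).summable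
  have hbs := summable_bilin hν hs hτ (h.decay t ht)
  have hsum : ∀ x, HasSum (fun k => (fourierCoef S k -
      bilin (symbolM ν) (fourierCoef (θ t)) (fourierCoef (θ t)) k) * mode k x)
      ((S x - advection ν (θ t) x : ℝ) : ℂ) := fun x => by
    have := (hS.hasSum x).sub (hasSum_advection hν hs hτ (h.decay t ht) x)
    rw [← Complex.ofReal_sub] at this
    exact this.congr_fun fun k => sub_mul _ _ _
  rw [← fourierCoef_of_hasSum (hSs.sub hbs) hsum k]
  have hcont : Continuous fun x => S x - advection ν (θ t) x :=
    continuous_of_hasSum (hSs.sub hbs) hsum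
  obtain ⟨L, hL, hhol⟩ := DecaySolution.exists_holder (T := T) hs hτ hC hB0 hB
  refine hasDerivWithinAt_of_norm_taylor_le (L := L) fun u hu => ?_
  have h1 : fourierCoef (θ u) k - fourierCoef (θ t) k -
      (u - t) • fourierCoef (fun x => S x - advection ν (θ t) x) k =
      fourierCoef ((θ u - θ t) - fun x => (u - t) * (S x - advection ν (θ t) x)) k := by
    rw [fourierCoef_sub ((h.decay u hu).continuous.sub (h.decay t ht).continuous)
      (hcont.const_mul _), fourierCoef_sub (h.decay u hu).continuous (h.decay t ht).continuous,
      fourierCoef_const_mul, Complex.real_smul]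
  rw [h1]
  refine norm_fourierCoef_le_of_abs_le (fun x => ?_) k
  refine abs_taylor_le_of_holder (F := fun t => θ t x)
    (G := fun t => S x - advection ν (θ t) x) hL
    (fun u hu => h.equation u hu x) (fun u hu u' hu' => ?_) ht hu
  have := hhol ν θ hν h u hu u' hu' x
  rwa [sub_sub_sub_cancel_left, abs_sub_comm]

/-- The barrier estimate with an exponential majorant. It is applied with `n k = |k|` for the a
priori bound and with `n k = 1` for stability. -/
theorem tsum_weight_mul_norm_le {T τ ρ κ β B₀ K : ℝ} (hκ : 0 ≤ κ) (hτρ : τ < ρ) {n : Freq → ℝ}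
    (hn : ∀ k, 0 ≤ n k) (hn1 : ∀ k, n k ≤ 1 + freqAbs k) {c c' : ℝ → Freq → ℂ} (hK0 : 0 ≤ K)
    (hc : ∀ t ∈ Icc 0 T, ∀ k, HasDerivWithinAt (fun t => c t k) (c' t k) (Icc 0 T) t)
    (hK : ∀ t ∈ Icc 0 T, ∀ k, ‖c t k‖ ≤ K * expWeight 1 (-ρ) k)
    (hK' : ∀ t ∈ Icc 0 T, ∀ k, ‖c' t k‖ ≤ K * expWeight 1 (-ρ) k)
    (h0 : ∑' k, n k * (expWeight 1 τ k * ‖c 0 k‖) ≤ B₀)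
    (hstep : ∀ t ∈ Ico 0 T,
      ∑' k, n k * (expWeight 1 (τ - κ * t) k * ‖c t k‖) = B₀ + β * t →
      ∑' k, n k * (expWeight 1 (τ - κ * t) k * (‖c' t k‖ - κ * (freqAbs k * ‖c t k‖))) < β)
    {t : ℝ} (ht : t ∈ Icc 0 T) :
    ∑' k, n k * (expWeight 1 (τ - κ * t) k * ‖c t k‖) ≤ B₀ + β * t := by
  have hsum : Summable fun k =>
      (1 + freqAbs k) * (n k * Real.exp (τ * freqAbs k) * (K * expWeight 1 (-ρ) k)) := by
    refine Summable.of_nonneg_of_le (fun k => ?_) (fun k => ?_)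
      ((summable_pow_mul_expWeight one_pos (sub_neg.mpr hτρ) 2).mul_left K)
    · have h1 := hn k
      have h2 := freqAbs_nonneg k
      have h3 := expWeight_pos 1 (-ρ) k
      positivity
    · have h1 := hn k
      have h2 := freqAbs_nonneg k
      have h3 := expWeight_pos 1 (-ρ) k
      have h4 := expWeight_pos 1 τ k
      rw [← expWeight_one]
      calc (1 + freqAbs k) * (n k * expWeight 1 τ k * (K * expWeight 1 (-ρ) k)) ≤
            (1 + freqAbs k) * ((1 + freqAbs k) * expWeight 1 τ k * (K * expWeight 1 (-ρ) k)) := by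
            gcongr; exact hn1 k
        _ = K * ((1 + freqAbs k) ^ 2 * (expWeight 1 τ k * expWeight 1 (-ρ) k)) := by ring
        _ = _ := by rw [expWeight_mul, sub_eq_add_neg]
  have := tsum_exp_mul_norm_le (τ := τ) (β := β) (B₀ := B₀) hκ hn hc hK hK' hsum
    (by simpa only [expWeight_one, mul_assoc] using h0)
    (by simpa only [expWeight_one, mul_assoc] using hstep) ht
  simpa only [expWeight_one, mul_assoc] using this

theorem ExpDecay.mono {s τ τ' C : ℝ} {f : Space → ℝ} (h : ExpDecay s τ C f) (hC : 0 ≤ C)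
    (hτ : τ' ≤ τ) : ExpDecay s τ' C f where
  continuous := h.continuous
  bound k := (h.bound k).trans
    (mul_le_mul_of_nonneg_left (expWeight_le_expWeight (neg_le_neg hτ) s k) hC)
  hasSum := h.hasSum

theorem DecaySolution.mono {s τ τ' T T' C ν : ℝ} {S : Space → ℝ} {θ : ℝ → Space → ℝ}
    (h : DecaySolution s τ T C ν S θ) (hC : 0 ≤ C) (hτ : τ' ≤ τ) (hT : T' ≤ T) :
    DecaySolution s τ' T' C ν S θ where
  decay t ht := (h.decay t (Icc_subset_Icc_right hT ht)).mono hC hτ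
  equation t ht x := (h.equation t (Icc_subset_Icc_right hT ht) x).mono (Icc_subset_Icc_right hT)

/-! ### A priori bound independent of the viscosity. -/

/-- The Fourier coefficients of the right-hand side of the equation. -/
noncomputable def rhsCoef (ν : ℝ) (S f : Space → ℝ) (k : Freq) : ℂ :=
  fourierCoef S k - bilin (symbolM ν) (fourierCoef f) (fourierCoef f) k

/-- An exponentially decaying bound of the coefficients and of their time derivatives. -/
theorem exists_expWeight_bound {ρ ρ' C CS : ℝ} (hρ' : 0 ≤ ρ') (hρ : ρ' < ρ) (hC : 0 ≤ C)
    (hCS : 0 ≤ CS) {S : Space → ℝ} (hS : ExpDecay 1 ρ CS S) :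
    ∃ K, 0 ≤ K ∧ ∀ ν, 0 ≤ ν → ∀ f : Space → ℝ, ExpDecay 1 ρ C f → ∀ k,
      ‖fourierCoef f k‖ ≤ K * expWeight 1 (-ρ') k ∧ ‖rhsCoef ν S f k‖ ≤ K * expWeight 1 (-ρ') k := by
  set D := 6 * (C * weightSum 1 (ρ - ρ')) * (C * weightSum 1 (ρ - ρ')) with hD
  have hW := weightSum_nonneg 1 (ρ - ρ')
  have hD0 : 0 ≤ D := by positivity
  refine ⟨C + CS + D, by positivity, fun ν hν f hf k => ?_⟩
  have hw := expWeight_pos 1 (-ρ') k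
  have h1 := (hf.mono hC hρ.le).bound k
  have h2 := (hS.mono hCS hρ.le).bound k
  have h3 := norm_bilin_le_expWeight hρ' hρ (sum_abs_symbolM_le hν) hf.bound hf.bound
    (by norm_num) hC k
  refine ⟨h1.trans (mul_le_mul_of_nonneg_right (by linarith) hw.le), ?_⟩
  refine (norm_sub_le _ _).trans ?_
  rw [add_mul, add_mul]
  have := mul_nonneg hC hw.le
  linarith

section

variable {ρ τ C : ℝ} {a : Freq → ℂ}

theorem summable_weight_mul_norm (h : τ < ρ) (ha : ∀ k, ‖a k‖ ≤ C * expWeight 1 (-ρ) k) :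
    Summable fun k => expWeight 1 τ k * ‖a k‖ := by
  simpa using summable_pow_mul_weight_mul_norm h ha 0

theorem summable_freqAbs_mul_weight_mul_norm (h : τ < ρ)
    (ha : ∀ k, ‖a k‖ ≤ C * expWeight 1 (-ρ) k) :
    Summable fun k => freqAbs k * (expWeight 1 τ k * ‖a k‖) :=
  summable_weight_mul_of_le h ha 1 (D := 1) freqAbs_nonneg fun k => by rw [pow_one]; linarith

theorem summable_freqAbs_sq_mul_weight_mul_norm (h : τ < ρ)
    (ha : ∀ k, ‖a k‖ ≤ C * expWeight 1 (-ρ) k) :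
    Summable fun k => freqAbs k * (freqAbs k * (expWeight 1 τ k * ‖a k‖)) :=
  (summable_weight_mul_of_le h ha 2 (D := 1) (q := fun k => freqAbs k * freqAbs k)
    (fun k => mul_self_nonneg _) fun k => by nlinarith [freqAbs_nonneg k]).congr
    fun k => mul_assoc _ _ _

end

/-- An a priori bound for the equation in a weighted `ℓ¹` norm which is uniform in the
viscosity. -/
theorem DecaySolution.tsum_le {ρ T C ν CS Z₀ Z κ : ℝ} {S : Space → ℝ} {θ : ℝ → Space → ℝ}
    (h : DecaySolution 1 ρ T C ν S θ) (hρ : 0 < ρ) (hν : 0 ≤ ν) (hC : 0 ≤ C)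
    (hS : ExpDecay 1 ρ CS S) (hCS : 0 ≤ CS) {B : ℝ} (hB0 : 0 ≤ B) (hB : ∀ x, |S x| ≤ B)
    (h0 : ∑' k, freqAbs k * (expWeight 1 (ρ / 2) k * ‖fourierCoef (θ 0) k‖) ≤ Z₀)
    (hZ : Z₀ + ((∑' k, freqAbs k * (expWeight 1 (ρ / 2) k * ‖fourierCoef S k‖)) + 1) * T ≤ Z)
    (hκ : 12 * Z ≤ κ) (hκ0 : 0 ≤ κ) (hκT : κ * T ≤ ρ / 2) {t : ℝ} (ht : t ∈ Icc 0 T) :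
    ∑' k, freqAbs k * (expWeight 1 (ρ / 2 - κ * t) k * ‖fourierCoef (θ t) k‖) ≤ Z := by
  set σ := ∑' k, freqAbs k * (expWeight 1 (ρ / 2) k * ‖fourierCoef S k‖) with hσ
  have hσ0 : 0 ≤ σ := tsum_nonneg fun k => mul_nonneg (freqAbs_nonneg k)
    (mul_nonneg (expWeight_pos _ _ _).le (norm_nonneg _))
  -- The radius `3ρ/4` lies strictly between that of the weight, `ρ/2`, and that of the solution,
  -- `ρ`. The constant `K` depends on `C` but does not enter the final bound.
  obtain ⟨K, hK0, hK⟩ := exists_expWeight_bound (ρ' := 3 * ρ / 4) (by positivity) (by linarith) hC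
    hCS hS
  have hle : ∀ t ∈ Icc 0 T, Z₀ + (σ + 1) * t ≤ Z := fun t ht =>
    le_trans (by gcongr; exact ht.2) hZ
  refine le_trans (tsum_weight_mul_norm_le (B₀ := Z₀) (β := σ + 1) (ρ := 3 * ρ / 4)
    (c := fun t => fourierCoef (θ t)) (c' := fun t => rhsCoef ν S (θ t)) hκ0 (by linarith)
    freqAbs_nonneg (fun k => by linarith) hK0
    (fun t ht k => h.hasDerivWithinAt_fourierCoef one_pos hρ hC hν hρ hS hB0 hB ht k)
    (fun t ht k => (hK ν hν _ (h.decay t ht) k).1) (fun t ht k => (hK ν hν _ (h.decay t ht) k).2)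
    h0 (fun t ht heq => ?_) ht) (hle t ht)
  have htI := Ico_subset_Icc_self ht
  set τ := ρ / 2 - κ * t with hτ
  have hτ0 : 0 ≤ τ := by
    have := mul_le_mul_of_nonneg_left htI.2 hκ0
    linarith
  have hτ1 : τ ≤ ρ / 2 := sub_le_self _ (mul_nonneg hκ0 ht.1)
  have hτρ : τ < ρ := by linarith
  have hc := (h.decay t htI).bound
  set a := fourierCoef (θ t) with ha
  have s1 := summable_freqAbs_mul_weight_mul_norm hτρ hc
  have s2 := summable_freqAbs_sq_mul_weight_mul_norm hτρ hc
  set Y := ∑' k, freqAbs k * (expWeight 1 τ k * ‖a k‖) with hY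
  set W := ∑' k, freqAbs k * (freqAbs k * (expWeight 1 τ k * ‖a k‖)) with hW
  -- At a touching time `Y` equals the barrier, hence is at most `Z`; this closes the nonlinear
  -- estimate.
  have hYZ : Y ≤ Z := heq.trans_le (hle t htI)
  have hW0 : 0 ≤ W := tsum_nonneg fun k => mul_nonneg (freqAbs_nonneg k)
    (mul_nonneg (freqAbs_nonneg k) (mul_nonneg (expWeight_pos _ _ _).le (norm_nonneg _)))
  have eA : (fun k => expWeight 1 τ k * (6 * freqAbs k * ‖a k‖)) =
      fun k => 6 * (freqAbs k * (expWeight 1 τ k * ‖a k‖)) := by ext k; ring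
  have eA' : (fun k => freqAbs k * (expWeight 1 τ k * (6 * freqAbs k * ‖a k‖))) =
      fun k => 6 * (freqAbs k * (freqAbs k * (expWeight 1 τ k * ‖a k‖))) := by ext k; ring
  have eB : (fun k => expWeight 1 τ k * (freqAbs k * ‖a k‖)) =
      fun k => freqAbs k * (expWeight 1 τ k * ‖a k‖) := by ext k; ring
  have eB' : (fun k => freqAbs k * (expWeight 1 τ k * (freqAbs k * ‖a k‖))) =
      fun k => freqAbs k * (freqAbs k * (expWeight 1 τ k * ‖a k‖)) := by ext k; ring
  -- The bilinear term costs `6WY + 6YW = 12YW`, and `12Y ≤ 12Z ≤ κ` lets the damping `-κW` absorb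
  -- it. The source contributes at most `σ`, and the spare `1` in `β = σ + 1` makes the inequality
  -- strict.
  have hbil := tsum_freqAbs_mul_weight_mul_norm_bilin_le (a := a) (b := a) hτ0
    (sum_abs_symbolM_le hν) (eA ▸ s1.mul_left 6) (eB ▸ s1) (eA' ▸ s2.mul_left 6) (eB' ▸ s2)
  rw [eA, eA', eB, eB', tsum_mul_left, tsum_mul_left] at hbil
  have sS := summable_freqAbs_mul_weight_mul_norm hτρ hS.bound
  have hSσ : ∑' k, freqAbs k * (expWeight 1 τ k * ‖fourierCoef S k‖) ≤ σ :=
    sS.tsum_le_tsum (fun k => mul_le_mul_of_nonneg_left (mul_le_mul_of_nonneg_right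
      (expWeight_le_expWeight hτ1 1 k) (norm_nonneg _)) (freqAbs_nonneg k))
      (summable_freqAbs_mul_weight_mul_norm (by linarith) hS.bound)
  have sc' := summable_freqAbs_mul_weight_mul_norm (τ := τ) (by linarith)
    fun k => (hK ν hν _ (h.decay t htI) k).2
  have hf : ∑' k, freqAbs k * (expWeight 1 τ k * (‖rhsCoef ν S (θ t) k‖ - κ * (freqAbs k * ‖a k‖))) =
      ∑' k, freqAbs k * (expWeight 1 τ k * ‖rhsCoef ν S (θ t) k‖) - κ * W := by
    rw [hW, ← tsum_mul_left, ← sc'.tsum_sub (s2.mul_left κ)]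
    exact tsum_congr fun k => by ring
  have hrhs : ∑' k, freqAbs k * (expWeight 1 τ k * ‖rhsCoef ν S (θ t) k‖) ≤
      ∑' k, freqAbs k * (expWeight 1 τ k * ‖fourierCoef S k‖) +
      ∑' k, freqAbs k * (expWeight 1 τ k * ‖bilin (symbolM ν) a a k‖) := by
    rw [← sS.tsum_add hbil.1]
    refine sc'.tsum_le_tsum (fun k => ?_) (sS.add hbil.1)
    rw [← mul_add, ← mul_add]
    exact mul_le_mul_of_nonneg_left (mul_le_mul_of_nonneg_left (norm_sub_le _ _)
      (expWeight_pos _ _ _).le) (freqAbs_nonneg k)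
  change ∑' k, freqAbs k * (expWeight 1 τ k *
    (‖rhsCoef ν S (θ t) k‖ - κ * (freqAbs k * ‖a k‖))) < σ + 1
  rw [hf]
  have h1 : 12 * Y * W ≤ κ * W := mul_le_mul_of_nonneg_right (by linarith) hW0
  linarith [hbil.2]

/-! ### Stability with respect to the viscosity. -/

/-- Total variation of the symbol between viscosity `ν` and viscosity `0`. -/
noncomputable def symbolGap (ν : ℝ) (k : Freq) : ℝ := ∑ j, |(symbolM ν - symbolM 0) k j|

theorem symbolGap_nonneg (ν : ℝ) (k : Freq) : 0 ≤ symbolGap ν k :=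
  Finset.sum_nonneg fun _ _ => abs_nonneg _

theorem symbolGap_le {ν : ℝ} (hν : 0 ≤ ν) (k : Freq) : symbolGap ν k ≤ 12 * freqAbs k := by
  have h : symbolGap ν k ≤ ∑ j, |symbolM ν k j| + ∑ j, |symbolM 0 k j| := by
    rw [← Finset.sum_add_distrib]
    exact Finset.sum_le_sum fun j _ => abs_sub _ _
  linarith [sum_abs_symbolM_le hν k, sum_abs_symbolM_le le_rfl k]

theorem tendsto_symbolGap (k : Freq) : Tendsto (fun ν => symbolGap ν k) (𝓝 0) (𝓝 0) := by
  have : Tendsto (fun ν => symbolGap ν k) (𝓝 0) (𝓝 (∑ _j : Fin 3, 0)) :=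
    tendsto_finsetSum _ fun j _ => by
      simpa using ((tendsto_symbolM k j).sub_const (symbolM 0 k j)).abs
  simpa using this

/-- The weighted size of the symbol gap. -/
noncomputable def weightedGap (ρ ν : ℝ) : ℝ := ∑' k, symbolGap ν k * expWeight 1 (-(ρ / 2)) k

theorem summable_freqAbs_mul_expWeight {ρ : ℝ} (hρ : 0 < ρ) :
    Summable fun k => freqAbs k * expWeight 1 (-ρ) k :=
  Summable.of_nonneg_of_le (fun k => mul_nonneg (freqAbs_nonneg k) (expWeight_pos _ _ _).le)
    (fun k => mul_le_mul_of_nonneg_right (by linarith) (expWeight_pos _ _ _).le)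
    (summable_weight one_pos hρ)

theorem summable_symbolGap_mul {ρ ν : ℝ} (hρ : 0 < ρ) (hν : 0 ≤ ν) :
    Summable fun k => symbolGap ν k * expWeight 1 (-(ρ / 2)) k :=
  Summable.of_nonneg_of_le (fun k => mul_nonneg (symbolGap_nonneg ν k) (expWeight_pos _ _ _).le)
    (fun k => (mul_le_mul_of_nonneg_right (symbolGap_le hν k) (expWeight_pos _ _ _).le).trans_eq
      (mul_assoc _ _ _))
    ((summable_freqAbs_mul_expWeight (half_pos hρ)).mul_left 12)

/-- The gap tends to `0` at each fixed `k`; the uniform bound `12|k|` and the exponential weight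
supply the domination. -/
theorem tendsto_weightedGap {ρ : ℝ} (hρ : 0 < ρ) :
    Tendsto (weightedGap ρ) (𝓝[>] 0) (𝓝 0) := by
  have h := tendsto_tsum_of_dominated_convergence (𝓕 := 𝓝[>] (0 : ℝ))
    (f := fun ν k => symbolGap ν k * expWeight 1 (-(ρ / 2)) k) (g := fun _ => 0)
    ((summable_freqAbs_mul_expWeight (half_pos hρ)).mul_left 12) (fun k => by
      simpa using ((tendsto_symbolGap k).mono_left nhdsWithin_le_nhds).mul_const
        (expWeight 1 (-(ρ / 2)) k)) (by
      filter_upwards [self_mem_nhdsWithin] with ν hν k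
      rw [Real.norm_of_nonneg (mul_nonneg (symbolGap_nonneg ν k) (expWeight_pos _ _ _).le)]
      exact (mul_le_mul_of_nonneg_right (symbolGap_le (le_of_lt hν) k)
        (expWeight_pos _ _ _).le).trans_eq (mul_assoc _ _ _))
  rw [tsum_zero] at h
  exact h

/-- Stability with respect to the viscosity. -/
theorem norm_fourierCoef_sub_le_of_tsum_le {ρ T C C' ν CS Z κ ε : ℝ} {S : Space → ℝ}
    {θ ϑ : ℝ → Space → ℝ} (h : DecaySolution 1 ρ T C ν S θ) (h' : DecaySolution 1 ρ T C' 0 S ϑ)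
    (hρ : 0 < ρ) (hν : 0 ≤ ν) (hC : 0 ≤ C) (hC' : 0 ≤ C') (hS : ExpDecay 1 ρ CS S) (hCS : 0 ≤ CS)
    {B : ℝ} (hB0 : 0 ≤ B) (hB : ∀ x, |S x| ≤ B) (h0 : θ 0 = ϑ 0) (hκ : 12 * Z ≤ κ)
    (hκ0 : 0 ≤ κ) (hκT : κ * T ≤ ρ / 2)
    (hZ : ∀ t ∈ Icc 0 T,
      ∑' k, freqAbs k * (expWeight 1 (ρ / 2 - κ * t) k * ‖fourierCoef (θ t) k‖) ≤ Z)
    (hZ' : ∀ t ∈ Icc 0 T,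
      ∑' k, freqAbs k * (expWeight 1 (ρ / 2 - κ * t) k * ‖fourierCoef (ϑ t) k‖) ≤ Z)
    (hε : 0 < ε) {t : ℝ} (ht : t ∈ Icc 0 T) (k : Freq) :
    ‖fourierCoef (θ t) k - fourierCoef (ϑ t) k‖ ≤ (C' * weightedGap ρ ν * Z + ε) * t := by
  obtain ⟨K, hK0, hK⟩ := exists_expWeight_bound (ρ' := 3 * ρ / 4) (by positivity) (by linarith) hC
    hCS hS
  obtain ⟨K', hK0', hK'⟩ := exists_expWeight_bound (ρ' := 3 * ρ / 4) (by positivity) (by linarith)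
    hC' hCS hS
  have hτ0 : ∀ t ∈ Icc 0 T, 0 ≤ ρ / 2 - κ * t := fun t ht => by
    have := mul_le_mul_of_nonneg_left ht.2 hκ0
    linarith
  have hd : ∀ t ∈ Icc 0 T, ∀ k, ‖(fourierCoef (θ t) - fourierCoef (ϑ t)) k‖ ≤
      (C + C') * expWeight 1 (-ρ) k := fun t ht k =>
    (norm_sub_le _ _).trans (by
      rw [add_mul]; exact add_le_add ((h.decay t ht).bound k) ((h'.decay t ht).bound k))
  -- The weight `n = 1` is one derivative weaker than in the a priori bound, so the derivative
  -- falling on the difference is exactly what the damping controls. The initial data agree, whence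
  -- `B₀ = 0`; `ε` only makes the inequality strict.
  have main := tsum_weight_mul_norm_le (τ := ρ / 2) (B₀ := 0) (β := C' * weightedGap ρ ν * Z + ε)
    (ρ := 3 * ρ / 4) (n := fun _ => 1) (K := K + K')
    (c := fun t => fourierCoef (θ t) - fourierCoef (ϑ t))
    (c' := fun t => rhsCoef ν S (θ t) - rhsCoef 0 S (ϑ t)) hκ0 (by linarith)
    (fun _ => zero_le_one) (fun k => by linarith [freqAbs_nonneg k]) (by positivity)
    (fun t ht k => (h.hasDerivWithinAt_fourierCoef one_pos hρ hC hν hρ hS hB0 hB ht k).sub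
      (h'.hasDerivWithinAt_fourierCoef one_pos hρ hC' le_rfl hρ hS hB0 hB ht k))
    (fun t ht k => (norm_sub_le _ _).trans (by
      rw [add_mul]; exact add_le_add (hK ν hν _ (h.decay t ht) k).1
        (hK' 0 le_rfl _ (h'.decay t ht) k).1))
    (fun t ht k => (norm_sub_le _ _).trans (by
      rw [add_mul]; exact add_le_add (hK ν hν _ (h.decay t ht) k).2
        (hK' 0 le_rfl _ (h'.decay t ht) k).2))
    (by simp [h0]) (fun t ht _ => ?_) ht
  · simp only [one_mul, zero_add] at main
    have hτ1 : ρ / 2 - κ * t ≤ ρ / 2 := sub_le_self _ (mul_nonneg hκ0 ht.1)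
    have hs := summable_weight_mul_norm (τ := ρ / 2 - κ * t) (by linarith) (hd t ht)
    refine le_trans ?_ main
    refine le_trans ?_ (hs.le_tsum k fun j _ => mul_nonneg (expWeight_pos _ _ _).le (norm_nonneg _))
    exact le_mul_of_one_le_left (norm_nonneg _) (one_le_expWeight_one (hτ0 t ht) k)
  have htI := Ico_subset_Icc_self ht
  have hτ0 := hτ0 t htI
  have hτ1 : ρ / 2 - κ * t ≤ ρ / 2 := sub_le_self _ (mul_nonneg hκ0 ht.1)
  have hZt := hZ t htI
  have hZt' := hZ' t htI
  have hc := (h.decay t htI).bound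
  have hc' := (h'.decay t htI).bound
  have hd := hd t htI
  set τ := ρ / 2 - κ * t with hτ
  have hτρ : τ < ρ := by linarith
  set a := fourierCoef (θ t) with ha
  set b := fourierCoef (ϑ t) with hb
  have e : ∀ (m : ℝ) (u : Freq → ℂ), (fun k => expWeight 1 τ k * (m * freqAbs k * ‖u k‖)) =
      fun k => m * (freqAbs k * (expWeight 1 τ k * ‖u k‖)) := fun m u => by ext k; ring
  have e1 : ∀ (u : Freq → ℂ), (fun k => expWeight 1 τ k * (freqAbs k * ‖u k‖)) =
      fun k => freqAbs k * (expWeight 1 τ k * ‖u k‖) := fun u => by ext k; ring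
  have sa := summable_freqAbs_mul_weight_mul_norm hτρ hc
  have sb := summable_freqAbs_mul_weight_mul_norm hτρ hc'
  have sd := summable_freqAbs_mul_weight_mul_norm hτρ hd
  -- The inviscid coefficients decay at radius `ρ` and the weight uses at most `ρ/2` of it; the rest
  -- is the weight in `weightedGap`.
  have sgb : ∀ k, expWeight 1 τ k * (symbolGap ν k * ‖b k‖) ≤
      C' * (symbolGap ν k * expWeight 1 (-(ρ / 2)) k) := fun k => by
    have h1 := symbolGap_nonneg ν k
    have h2 := expWeight_pos 1 (-ρ) k
    have h3 : expWeight 1 (-(ρ / 2)) k = expWeight 1 (ρ / 2) k * expWeight 1 (-ρ) k := by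
      rw [expWeight_mul]; congr 1; ring
    have h4 := expWeight_pos 1 τ k
    calc expWeight 1 τ k * (symbolGap ν k * ‖b k‖) ≤
          expWeight 1 (ρ / 2) k * (symbolGap ν k * (C' * expWeight 1 (-ρ) k)) := by
          gcongr ?_ * (_ * ?_)
          · exact (expWeight_pos _ _ _).le
          · exact expWeight_le_expWeight hτ1 1 k
          · exact hc' k
      _ = _ := by rw [h3]; ring
  have sg : Summable fun k => expWeight 1 τ k * (symbolGap ν k * ‖b k‖) :=
    Summable.of_nonneg_of_le (fun k => mul_nonneg (expWeight_pos _ _ _).le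
      (mul_nonneg (symbolGap_nonneg ν k) (norm_nonneg _))) sgb
      ((summable_symbolGap_mul hρ hν).mul_left C')
  have hgap : ∑' k, expWeight 1 τ k * (symbolGap ν k * ‖b k‖) ≤ C' * weightedGap ρ ν := by
    rw [weightedGap, ← tsum_mul_left]
    exact sg.tsum_le_tsum sgb ((summable_symbolGap_mul hρ hν).mul_left C')
  have hM := sum_abs_symbolM_le hν
  have hM0 := sum_abs_symbolM_le (le_refl (0 : ℝ))
  have hG : ∀ k, ∑ j, |(symbolM ν - symbolM 0) k j| ≤ symbolGap ν k := fun k => le_rfl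
  have b1 := tsum_weight_mul_norm_bilin_le (a := a - b) (b := a) hτ0 hM
    (e 6 (a - b) ▸ sd.mul_left 6) (e1 a ▸ sa)
  have b2 := tsum_weight_mul_norm_bilin_le (a := b) (b := a) hτ0 hG sg (e1 a ▸ sa)
  have b3 := tsum_weight_mul_norm_bilin_le (a := b) (b := a - b) hτ0 hM0
    (e 6 b ▸ sb.mul_left 6) (e1 (a - b) ▸ sd)
  have hsplit : ∀ k, ‖(rhsCoef ν S (θ t) - rhsCoef 0 S (ϑ t)) k‖ ≤
      ‖bilin (symbolM ν) (a - b) a k‖ + ‖bilin (symbolM ν - symbolM 0) b a k‖ +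
      ‖bilin (symbolM 0) b (a - b) k‖ := fun k => by
    have := bilin_sub_bilin
      (bilinBound_of_summable hτ0 hM (e 6 a ▸ sa.mul_left 6) (e1 a ▸ sa))
      (bilinBound_of_summable hτ0 hM0 (e 6 b ▸ sb.mul_left 6) (e1 b ▸ sb))
      (bilinBound_of_summable hτ0 hM (e 6 (a - b) ▸ sd.mul_left 6) (e1 a ▸ sa))
      (bilinBound_of_summable hτ0 hG sg (e1 a ▸ sa))
      (bilinBound_of_summable hτ0 hM0 (e 6 b ▸ sb.mul_left 6) (e1 (a - b) ▸ sd)) k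
    rw [Pi.sub_apply, rhsCoef, rhsCoef, sub_sub_sub_cancel_left, norm_sub_rev, this]
    exact norm_add₃_le
  rw [e, e1, tsum_mul_left] at b1
  rw [e1] at b2
  rw [e, e1, tsum_mul_left] at b3
  set Y := ∑' k, freqAbs k * (expWeight 1 τ k * ‖(a - b) k‖) with hY
  have hY0 : 0 ≤ Y := tsum_nonneg fun k => mul_nonneg (freqAbs_nonneg k)
    (mul_nonneg (expWeight_pos _ _ _).le (norm_nonneg _))
  have hgap0 : 0 ≤ C' * weightedGap ρ ν := mul_nonneg hC' (tsum_nonneg fun k =>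
    mul_nonneg (symbolGap_nonneg ν k) (expWeight_pos _ _ _).le)
  have hsum3 := (b1.1.add b2.1).add b3.1
  have hle3 : ∀ k, expWeight 1 τ k * ‖(rhsCoef ν S (θ t) - rhsCoef 0 S (ϑ t)) k‖ ≤
      expWeight 1 τ k * ‖bilin (symbolM ν) (a - b) a k‖ +
      expWeight 1 τ k * ‖bilin (symbolM ν - symbolM 0) b a k‖ +
      expWeight 1 τ k * ‖bilin (symbolM 0) b (a - b) k‖ := fun k => by
    rw [← mul_add, ← mul_add]
    exact mul_le_mul_of_nonneg_left (hsplit k) (expWeight_pos _ _ _).le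
  have sc' : Summable fun k => expWeight 1 τ k * ‖(rhsCoef ν S (θ t) - rhsCoef 0 S (ϑ t)) k‖ :=
    Summable.of_nonneg_of_le (fun k => mul_nonneg (expWeight_pos _ _ _).le (norm_nonneg _)) hle3
      hsum3
  have hrhs := sc'.tsum_le_tsum hle3 hsum3
  rw [(b1.1.add b2.1).tsum_add b3.1, b1.1.tsum_add b2.1] at hrhs
  have hf : ∑' k, 1 * (expWeight 1 τ k * (‖(rhsCoef ν S (θ t) - rhsCoef 0 S (ϑ t)) k‖ -
      κ * (freqAbs k * ‖(a - b) k‖))) =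
      ∑' k, expWeight 1 τ k * ‖(rhsCoef ν S (θ t) - rhsCoef 0 S (ϑ t)) k‖ - κ * Y := by
    rw [hY, ← tsum_mul_left, ← sc'.tsum_sub (sd.mul_left κ)]
    exact tsum_congr fun k => by ring
  change ∑' k, 1 * (expWeight 1 τ k * (‖(rhsCoef ν S (θ t) - rhsCoef 0 S (ϑ t)) k‖ -
      κ * (freqAbs k * ‖(a - b) k‖))) < _
  rw [hf]
  -- The terms from `a - b` cost `6YZ` each, together `12ZY ≤ κY`, which the damping cancels; only
  -- the gap term survives.
  have c1 := b1.2.trans (mul_le_mul_of_nonneg_left hZt (by positivity))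
  have c2 := b2.2.trans (mul_le_mul hgap hZt (tsum_nonneg fun k => mul_nonneg (freqAbs_nonneg k)
    (mul_nonneg (expWeight_pos _ _ _).le (norm_nonneg _))) hgap0)
  have c3 := b3.2.trans (mul_le_mul_of_nonneg_right
    (mul_le_mul_of_nonneg_left hZt' (by norm_num : (0 : ℝ) ≤ 6)) hY0)
  have c4 : 12 * Z * Y ≤ κ * Y := mul_le_mul_of_nonneg_right hκ hY0
  linarith

/-! ### Conclusion of the analytic case and of the theorem. -/

theorem norm_le_mul_expWeight_of_tsum_le {ρ τ σ C Z : ℝ} (hτρ : τ < ρ) (hσ : σ ≤ τ) {a : Freq → ℂ}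
    (ha : ∀ k, ‖a k‖ ≤ C * expWeight 1 (-ρ) k) (ha0 : a 0 = 0)
    (h : ∑' k, freqAbs k * (expWeight 1 τ k * ‖a k‖) ≤ Z) (hZ : 0 ≤ Z) (k : Freq) :
    ‖a k‖ ≤ Z * expWeight 1 (-σ) k := by
  by_cases hk : k = 0
  · rw [hk, ha0, norm_zero]
    exact mul_nonneg hZ (expWeight_pos _ _ _).le
  have h1 := ((summable_freqAbs_mul_weight_mul_norm hτρ ha).le_tsum k fun j _ =>
    mul_nonneg (freqAbs_nonneg j) (mul_nonneg (expWeight_pos _ _ _).le (norm_nonneg _))).trans h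
  have h2 : expWeight 1 σ k * ‖a k‖ ≤ Z := by
    refine le_trans ?_ h1
    refine le_trans ?_ (le_mul_of_one_le_left (mul_nonneg (expWeight_pos _ _ _).le (norm_nonneg _))
      (one_le_freqAbs hk))
    exact mul_le_mul_of_nonneg_right (expWeight_le_expWeight hσ 1 k) (norm_nonneg _)
  have h3 : ‖a k‖ = expWeight 1 σ k * ‖a k‖ * expWeight 1 (-σ) k := by
    rw [mul_right_comm, expWeight_mul]; simp [expWeight]
  rw [h3]
  exact mul_le_mul_of_nonneg_right h2 (expWeight_pos _ _ _).le

/-- The analytic case. -/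
theorem exists_tendsto_gevreyNorm_analytic {r τ₀ τ T₀ : ℝ} (hr : 0 ≤ r) (hτ₀ : 0 < τ₀)
    (hτ : 0 < τ) (hT₀ : 0 < T₀) {S θ₀ : Space → ℝ} (hS : IsGevrey 1 r τ₀ S)
    {θ : ℝ → ℝ → Space → ℝ} {ϑ : ℝ → Space → ℝ}
    (hθ : ∀ ν, 0 < ν → IsGevreySolution 1 r τ T₀ ν S θ₀ (θ ν))
    (hϑ : IsGevreySolution 1 r τ T₀ 0 S θ₀ ϑ) :
    ∃ T, 0 < T ∧ T < T₀ ∧ ∃ σ, 0 < σ ∧ σ < τ ∧ ∀ t ∈ Icc 0 T,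
      Tendsto (fun ν => gevreyNorm 1 r σ (θ ν t - ϑ t)) (𝓝[>] 0) (𝓝 0) := by
  -- A common radius for the source, known at `τ₀`, and for the solutions, known at `τ`.
  set ρ := min τ₀ τ with hρdef
  have hρ : 0 < ρ := lt_min hτ₀ hτ
  have hρτ : ρ ≤ τ := min_le_right _ _
  obtain ⟨CS, hCS⟩ := hS.exists_expDecay one_pos hr hτ₀
  obtain ⟨B, hB0, hB⟩ := hS.exists_abs_le one_pos hr hτ₀
  have hS' : ExpDecay 1 ρ CS S := hCS.mono CS.coe_nonneg (min_le_left _ _)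
  set Z₀ := ∑' k, freqAbs k * (expWeight 1 (ρ / 2) k * ‖fourierCoef θ₀ k‖) with hZ₀
  set σ := ∑' k, freqAbs k * (expWeight 1 (ρ / 2) k * ‖fourierCoef S k‖) with hσ
  have hnn : ∀ u : Freq → ℂ, 0 ≤ ∑' k, freqAbs k * (expWeight 1 (ρ / 2) k * ‖u k‖) := fun u =>
    tsum_nonneg fun k => mul_nonneg (freqAbs_nonneg k)
      (mul_nonneg (expWeight_pos _ _ _).le (norm_nonneg _))
  have hZ₀0 : 0 ≤ Z₀ := hnn _
  have hσ0 : 0 ≤ σ := hnn _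
  set Z := Z₀ + (σ + 1) with hZ
  have hZ0 : 0 < Z := by positivity
  set κ := 12 * Z with hκ
  have hκ0 : 0 < κ := by positivity
  -- The three bounds give `T < T₀`, keep the barrier below `Z`, and keep the radius `ρ/2 - κt` at
  -- least `ρ/4`.
  set T := min (T₀ / 2) (min 1 (ρ / 4 / κ)) with hT
  have hT0 : 0 < T := lt_min (by positivity) (lt_min one_pos (by positivity))
  have hTT : T ≤ T₀ := (min_le_left _ _).trans (by linarith)
  have hT1 : T ≤ 1 := (min_le_right _ _).trans (min_le_left _ _)
  have hκT : κ * T ≤ ρ / 4 := by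
    have : T ≤ ρ / 4 / κ := (min_le_right _ _).trans (min_le_right _ _)
    rw [le_div_iff₀ hκ0] at this
    linarith
  have hZT : Z₀ + (σ + 1) * T ≤ Z := by
    have : (σ + 1) * T ≤ (σ + 1) * 1 := mul_le_mul_of_nonneg_left hT1 (by linarith)
    linarith
  have hbound : ∀ {ν C : ℝ} {f : ℝ → Space → ℝ}, 0 ≤ ν → 0 ≤ C → f 0 = θ₀ →
      DecaySolution 1 ρ T C ν S f → ∀ t ∈ Icc 0 T,
      ∑' k, freqAbs k * (expWeight 1 (ρ / 2 - κ * t) k * ‖fourierCoef (f t) k‖) ≤ Z :=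
    fun hν hC hf0 h t ht => h.tsum_le hρ hν hC hS' CS.coe_nonneg hB0 hB
      (by rw [hf0]) hZT le_rfl hκ0.le (by linarith) ht
  obtain ⟨C', hC'⟩ := hϑ.bounded
  have hϑs : DecaySolution 1 ρ T C' 0 S ϑ :=
    (hϑ.decaySolution one_pos hr hτ hC').mono C'.coe_nonneg hρτ hTT
  have hϑZ := hbound le_rfl C'.coe_nonneg hϑ.initial hϑs
  have hsol : ∀ ν, 0 < ν → ∃ C : ℝ≥0, DecaySolution 1 ρ T C ν S (θ ν) := fun ν hν => by
    obtain ⟨C, hC⟩ := (hθ ν hν).bounded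
    exact ⟨C, ((hθ ν hν).decaySolution one_pos hr hτ hC).mono C.coe_nonneg hρτ hTT⟩
  -- Uniform bounds hold at radius `ρ/4`, so any smaller radius, here `ρ/8`, admits convergence.
  refine ⟨T, hT0, (min_le_left _ _).trans_lt (by linarith), ρ / 8, by positivity, by linarith,
    fun t ht => ?_⟩
  have htI : t ∈ Icc 0 T₀ := Icc_subset_Icc_right hTT ht
  have hτt : ρ / 4 ≤ ρ / 2 - κ * t := by
    have := mul_le_mul_of_nonneg_left ht.2 hκ0.le
    linarith
  have hτt' : ρ / 2 - κ * t < ρ := by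
    have := mul_nonneg hκ0.le ht.1
    linarith
  have hpos : ∀ᶠ ν in 𝓝[>] (0 : ℝ), 0 < ν := self_mem_nhdsWithin
  refine tendsto_gevreyNorm_sub (τ' := ρ / 4) (C := Z) one_pos (by linarith)
    (hpos.mono fun ν hν => ((hθ ν hν).gevrey t htI).continuous) (hϑ.gevrey t htI).continuous
    (hpos.mono fun ν hν => ?_) ?_ fun k => ?_
  · obtain ⟨C, hC⟩ := hsol ν hν
    exact norm_le_mul_expWeight_of_tsum_le hτt' hτt (hC.decay t ht).bound
      (fourierCoef_zero ((hθ ν hν).gevrey t htI).mean_zero)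
      (hbound hν.le C.coe_nonneg (hθ ν hν).initial hC t ht) hZ0.le
  · exact norm_le_mul_expWeight_of_tsum_le hτt' hτt (hϑs.decay t ht).bound
      (fourierCoef_zero (hϑ.gevrey t htI).mean_zero) (hϑZ t ht) hZ0.le
  · rw [tendsto_iff_norm_sub_tendsto_zero]
    -- The slack `ε` of the stability estimate is taken to be `ν` itself. Only the inviscid constant
    -- `C'` appears, so the possibly `ν`-dependent constant of `θ ν` does no harm.
    have hlim : Tendsto (fun ν => (C' * weightedGap ρ ν * Z + ν) * t) (𝓝[>] 0) (𝓝 0) := by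
      have := ((((tendsto_weightedGap hρ).const_mul (C' : ℝ)).mul_const Z).add
        (tendsto_id'.mpr (nhdsWithin_le_nhds (a := (0 : ℝ)) (s := Ioi 0)))).mul_const t
      simpa using this
    refine squeeze_zero' (Eventually.of_forall fun _ => norm_nonneg _) ?_ hlim
    filter_upwards [hpos] with ν hν
    obtain ⟨C, hC⟩ := hsol ν hν
    exact norm_fourierCoef_sub_le_of_tsum_le hC hϑs hρ hν.le C.coe_nonneg C'.coe_nonneg hS'
      CS.coe_nonneg hB0 hB ((hθ ν hν).initial.trans hϑ.initial.symm) le_rfl hκ0.le (by linarith)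
      (hbound hν.le C.coe_nonneg (hθ ν hν).initial hC) hϑZ hν ht k

end MG

/-- Vanishing viscosity limit for the magnetogeostrophic equation in Gevrey classes. -/
theorem theorem6p6
    (s r K₀ τ₀ Tbar τbar : ℝ) (hs : 1 ≤ s) (hr : 3 < r) (hK₀ : 0 < K₀) (hτ₀ : 0 < τ₀)
    (hTbar : 0 < Tbar) (hτbar : 0 < τbar)
    (θ₀ S : MG.Space → ℝ)
    (hθ₀ : MG.IsGevrey s r τ₀ θ₀) (hS : MG.IsGevrey s r τ₀ S)
    (hθ₀K : MG.gevreyNorm s r τ₀ θ₀ ≤ ENNReal.ofReal K₀)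
    (hSK : MG.gevreyNorm s r τ₀ S ≤ ENNReal.ofReal K₀)
    -- the solutions for `ν > 0` and for `ν = 0`
    (θ : ℝ → ℝ → MG.Space → ℝ) (ϑ : ℝ → MG.Space → ℝ)
    (hθ : ∀ ν, 0 < ν → MG.IsGevreySolution s r τbar Tbar ν S θ₀ (θ ν))
    (hϑ : MG.IsGevreySolution s r τbar Tbar 0 S θ₀ ϑ)
    -- for `s > 1` only: the bound on the `θ ν` does not depend on `ν`, and `ϑ` is the unique
    -- solution in its class; nothing of this is assumed for `s = 1`
    (hbound : 1 < s → ∃ C : ℝ≥0, ∀ ν, 0 < ν → ∀ t ∈ Icc 0 Tbar,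
      MG.gevreyNorm s r τbar (θ ν t) ≤ C)
    (hunique : 1 < s → ∀ ϑ' : ℝ → MG.Space → ℝ,
      MG.IsGevreySolution s r τbar Tbar 0 S θ₀ ϑ' → ∀ t ∈ Icc 0 Tbar, ϑ' t = ϑ t) :
    ∃ T : ℝ, 0 < T ∧ T < Tbar ∧ ∃ τ : ℝ → ℝ, ContinuousOn τ (Icc 0 T) ∧
      (∀ t ∈ Icc 0 T, 0 < τ t ∧ τ t < τbar) ∧
      ∀ t ∈ Icc 0 T,
        Tendsto (fun ν => MG.gevreyNorm s r (τ t) (θ ν t - ϑ t)) (𝓝[>] 0) (𝓝 0) := by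
  have hs0 : 0 < s := zero_lt_one.trans_le hs
  have hr0 : 0 ≤ r := by linarith
  rcases hs.eq_or_lt with rfl | hs1
  · obtain ⟨T, hT, hTT, σ, hσ, hστ, h⟩ :=
      MG.exists_tendsto_gevreyNorm_analytic hr0 hτ₀ hτbar hTbar hS hθ hϑ
    exact ⟨T, hT, hTT, fun _ => σ, continuousOn_const, fun _ _ => ⟨hσ, hστ⟩, h⟩
  · obtain ⟨C, hC⟩ := hbound hs1
    -- Convergence holds on all of `[0, Tbar]` and at every radius below `τbar`; the halves only
    -- meet the strict inequalities.
    refine ⟨Tbar / 2, by positivity, by linarith, fun _ => τbar / 2, continuousOn_const,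
      fun _ _ => ⟨by positivity, by linarith⟩, fun t ht => ?_⟩
    exact MG.tendsto_gevreyNorm_of_bounded_of_unique hs0 hr0 hτ₀ hτbar hTbar.le hS hθ hϑ hC
      (hunique hs1) (by linarith) (Icc_subset_Icc_right (by linarith) ht)
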